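/- Let $\mathbf{k}$ be a commutative ring (with unity), let $k$ and $n$ be integers with $0\le k\le n$, and let $\mathcal{S}$ be the ring of symmetric polynomials in the polynomial ring $\mathbf{k}[x_1,\ldots,x_k]$. For each $m\ge 0$ let $h_m=\sum_{1\le i_1\le\cdots\le i_m\le k}x_{i_1}\cdots x_{i_m}\in\mathcal{S}$ be the $m$-th complete homogeneous symmetric polynomial. For each $i\in\{1,\ldots,k\}$ let $a_i\in\mathcal{S}$ be a symmetric polynomial, not necessarily homogeneous, of total degree $\deg a_i<n-k+i$. Let $I$ be the ideal of $\mathcal{S}$ generated by the $k$ differences $$h_{n-k+1}-a_1,\ h_{n-k+2}-a_2,\ \ldots,\ h_n-a_k .$$ Let $P_{k,n}$ be the set of all partitions that have at most $k$ parts (nonzero entries) and all of whose parts are $\le n-k$. For each partition $\lambda$, let $s_\lambda=\sum_T\prod_{c}x_{T(c)}$ be the Schur polynomial in $x_1,\ldots,x_k$, where $T$ ranges over all semistandard tableaux of shape $\lambda$ with entries in $\{1,\ldots,k\}$ (entries weakly increasing along rows, strictly increasing down columns) and $c$ ranges over the cells of $\lambda$; this is a symmetric polynomial. Then the $\mathbf{k}$-module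 $\mathcal{S}/I$ is free, and the family $(\overline{s_\lambda})_{\lambda\in P_{k,n}}$ of residue classes of the Schur polynomials $s_\lambda$ with $\lambda\in P_{k,n}$ is a basis of it. -/

import Mathlib

open MvPolynomial

noncomputable section

/-- The set of partitions (Young diagrams) having at most `k` parts, each part being at most
`n - k`. -/
def partitionsInRectangle (k n : ℕ) : Set YoungDiagram :=
  {μ | μ.rowLens.length ≤ k ∧ ∀ p ∈ μ.rowLens, p ≤ n - k}

/-- Semistandard tableaux of shape `μ` with entries in an alphabet with `k` letters, the letters
being `0, …, k - 1`. -/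
def BoundedSSYT (k : ℕ) (μ : YoungDiagram) : Type :=
  {T : SemistandardYoungTableau μ // ∀ c ∈ μ.cells, T c.1 c.2 < k}

instance BoundedSSYT.instFinite (k : ℕ) (μ : YoungDiagram) : Finite (BoundedSSYT k μ) := by
  refine Finite.of_injective
    (fun (T : BoundedSSYT k μ) (c : μ.cells) => (⟨T.1 c.1.1 c.1.2, T.2 c.1 c.2⟩ : Fin k)) ?_
  intro T T' h
  refine Subtype.ext (SemistandardYoungTableau.ext fun i j => ?_)
  by_cases hc : (i, j) ∈ μ
  · have h1 := congrFun h ⟨(i, j), (YoungDiagram.mem_cells _).2 hc⟩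
    exact congrArg Fin.val h1
  · rw [T.1.zeros hc, T'.1.zeros hc]

instance BoundedSSYT.instFintype (k : ℕ) (μ : YoungDiagram) : Fintype (BoundedSSYT k μ) := Fintype.ofFinite _

/-- The Schur polynomial `s_μ(x_1, …, x_k)`: the sum, over all semistandard tableaux of shape `μ`
with entries in a `k`-letter alphabet, of the product of the variables named by the entries. -/
def schurPolynomial (k : ℕ) (R : Type*) [CommRing R] (μ : YoungDiagram) :
    MvPolynomial (Fin k) R :=
  ∑ T : BoundedSSYT k μ, ∏ c : μ.cells, X ⟨T.1 c.1.1 c.1.2, T.2 c.1 c.2⟩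

/-- The complete homogeneous symmetric polynomial `h_m(x_1, …, x_k)`, as an element of the ring of
symmetric polynomials. -/
def completeHomogeneous (k : ℕ) (R : Type*) [CommRing R] (m : ℕ) :
    symmetricSubalgebra (Fin k) R :=
  ⟨hsymm (Fin k) R m, hsymm_isSymmetric (Fin k) R m⟩

/-- The ideal of the ring of symmetric polynomials in `k` variables generated by the differences
`h_{n-k+1} - a_1, …, h_n - a_k`; the element `a_{i+1}` is `a i`, for `i : Fin k`. -/
def grassmannianIdeal {R : Type*} [CommRing R] (k n : ℕ)
    (a : Fin k → symmetricSubalgebra (Fin k) R) : Ideal (symmetricSubalgebra (Fin k) R) :=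
  Ideal.span (Set.range fun i : Fin k =>
    completeHomogeneous k R (n - k + ((i : ℕ) + 1)) - a i)

end

/-! Write δ for the staircase alternant (the Vandermonde determinant) and `R` for the base ring.
Division with remainder by ∏ (T - x_i) gives a relation x_r ^ n = ∑ y_{rev c} x_r ^ c valid for
every variable. Multiplying h_{n-k+i+1} by δ and reducing with it yields h_{n-k+i+1} = ∑_{j ≤ i}
h_{i-j} y_j for i, j counted from 0. This unitriangular system determines y, and y_j is homogeneous
of degree n-k+j+1. Solving the same system with h_{n-k+i+1} - a_i on the left gives elements w_j
that generate the ideal and have leading part y_j.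

The theorem follows once the symmetric polynomials are free over `R[w]`, with the w_j algebraically
independent, on the Schur polynomials of the rectangle: killing the w_j leaves a free `R`-module on
the same family (`exists_basis_quotient_of_bijective`). By the bialternant formula
`schurSum_mul_staircase`, s_λ δ is an alternant with strictly increasing exponents, and λ lies in
the rectangle exactly when all exponents are below n.

Spanning (`exists_alternant_eq`): a symmetric polynomial times δ is a combination of alternants. An
exponent ≥ n is lowered by the relation; there y is replaced by w plus a symmetric error of lower
degree, so induction on total degree closes.

Independence: passing to leading parts replaces w by y (`injective_of_hasTop`). For y, adjoin
independent constants Y_c and work modulo all X_r ^ n - ∑ Y_{rev c} X_r ^ c. After multiplication by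
δ, Cramer's rule identifies y_c with Y_c (`mul_alternant_sub_mem`), and alternants with exponents
below n are separated by coefficient functionals that kill this ideal
(`eq_zero_of_sum_alternant_mem`). -/

/-! ### Alternants and their branching rule -/

section Alternant

variable {A : Type*} [CommRing A] {k : ℕ}

/-- The alternant `det (x_i ^ l_j)`. -/
def alternant (x : Fin k → A) (l : Fin k → ℕ) : A :=
  (Matrix.of fun j i => x i ^ l j).det

lemma alternant_eq_zero_of_not_injective (x : Fin k → A) {l : Fin k → ℕ}
    (hl : ¬ Function.Injective l) : alternant x l = 0 := by
  obtain ⟨i, j, h, hij⟩ := Function.not_injective_iff.1 hl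
  exact Matrix.det_zero_of_row_eq hij (by ext r; simp [h])

lemma alternant_comp_perm (x : Fin k → A) (l : Fin k → ℕ) (σ : Equiv.Perm (Fin k)) :
    alternant x (l ∘ σ) = (Equiv.Perm.sign σ : ℤ) * alternant x l :=
  Matrix.det_permute σ (Matrix.of fun j i => x i ^ l j)

lemma map_alternant {B F : Type*} [CommRing B] [FunLike F A B] [RingHomClass F A B] (f : F)
    (x : Fin k → A) (l : Fin k → ℕ) : f (alternant x l) = alternant (fun i => f (x i)) l := by
  have := RingHom.map_det (f : A →+* B) (Matrix.of fun j i => x i ^ l j)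
  simp only [RingHom.coe_coe] at this
  rw [alternant, this]
  congr 1
  ext i j
  simp

lemma alternant_staircase (x : Fin k → A) :
    alternant x (fun j => (j : ℕ)) = ∏ i, ∏ j ∈ Finset.Ioi i, (x j - x i) := by
  rw [← Matrix.det_vandermonde, ← Matrix.det_transpose]
  rfl

/-- Multilinearity in row i. This is the only rewriting rule for alternants with an exponent ≥ n. -/
lemma alternant_update_reduce {x : Fin k → A} {n : ℕ} {y : Fin k → A}
    (hy : ∀ r, x r ^ n = ∑ c, y c * x r ^ (c : ℕ)) (l : Fin k → ℕ) (i : Fin k) (d : ℕ) :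
    alternant x (Function.update l i (d + n)) =
      ∑ c, y c * alternant x (Function.update l i (d + c)) := by
  have key : ∀ e : ℕ, alternant x (Function.update l i e) =
      ((Matrix.of fun j r => x r ^ l j).updateRow i (fun r => x r ^ e)).det := by
    intro e
    rw [alternant]
    congr 1
    ext j r
    by_cases h : j = i
    · subst h; simp
    · simp [h]
  simp only [key]
  have : (fun r => x r ^ (d + n)) = ∑ c, y c • (fun r => x r ^ (d + (c : ℕ))) := by
    ext r
    rw [pow_add, hy, Finset.mul_sum, Finset.sum_apply]
    refine Finset.sum_congr rfl fun c _ => ?_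
    simp only [Pi.smul_apply, smul_eq_mul, pow_add]
    ring
  have hs : ∀ v : Fin k → A, ((Matrix.of fun j r => x r ^ l j).updateRow i v).det =
      (Matrix.detRowAlternating (R := A) (n := Fin k)).toMultilinearMap.toLinearMap
        (fun j r => x r ^ l j) i v := fun v => rfl
  rw [this, hs, map_sum]
  refine Finset.sum_congr rfl fun c _ => ?_
  rw [map_smul, hs, smul_eq_mul]

/-- Branching of alternants: removing the last variable. -/
lemma alternant_succ (x : Fin (k + 1) → A) {l : Fin (k + 1) → ℕ} (hl : Monotone l) :
    alternant x l = (∏ i : Fin k, (x (Fin.last k) - x i.castSucc)) * x (Fin.last k) ^ l 0 *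
      ∑ m ∈ Fintype.piFinset (fun j : Fin k => Finset.Ico (l j.castSucc) (l j.succ)),
        (∏ j : Fin k, x (Fin.last k) ^ (l j.succ - 1 - m j)) *
          alternant (fun i : Fin k => x i.castSucc) m := by
  set t := x (Fin.last k) with ht
  -- Subtracting t ^ (gap) times the previous row from each row makes x - t a factor of every lower
  -- row, by the geometric sum. The last column, where x = t, then keeps only its top entry.
  let B : Matrix (Fin (k + 1)) (Fin (k + 1)) A := Matrix.of fun j i =>
    Fin.cases (x i ^ l 0) (fun j : Fin k => (x i - t) *
      (∑ m ∈ Finset.Ico (l j.castSucc) (l j.succ), x i ^ m * t ^ (l j.succ - 1 - m))) j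
  have h1 : alternant x l = B.det := by
    refine Matrix.det_eq_of_forall_row_eq_smul_add_pred
      (fun j : Fin k => t ^ (l j.succ - l j.castSucc)) (fun j => ?_) (fun i j => ?_)
    · simp [B]
    · have := (Commute.all (x j) t).geom_sum₂_Ico_mul (hl i.castSucc_lt_succ.le)
      simp only [B, Matrix.of_apply, Fin.cases_succ]
      rw [mul_comm (x j - t), this]
      ring
  rw [h1, Matrix.det_succ_column B (Fin.last k), Finset.sum_eq_single 0]
  rotate_left
  · intro j _ hj
    obtain ⟨j, rfl⟩ := Fin.exists_succ_eq.2 hj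
    simp [B, ← ht]
  · simp
  have h2 : (B.submatrix (Fin.succAbove 0) (Fin.succAbove (Fin.last k))) =
      Matrix.of fun j i : Fin k => (x i.castSucc - t) * (Matrix.of fun j i : Fin k =>
        ∑ m ∈ Finset.Ico (l j.castSucc) (l j.succ),
          x i.castSucc ^ m * t ^ (l j.succ - 1 - m)) j i := by
    ext j i
    simp [B]
  rw [h2, Matrix.det_mul_row]
  have h3 : (Matrix.of fun j i : Fin k => ∑ m ∈ Finset.Ico (l j.castSucc) (l j.succ),
      x i.castSucc ^ m * t ^ (l j.succ - 1 - m)).det =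
      ∑ m ∈ Fintype.piFinset (fun j : Fin k => Finset.Ico (l j.castSucc) (l j.succ)),
        (∏ j : Fin k, t ^ (l j.succ - 1 - m j)) *
          alternant (fun i : Fin k => x i.castSucc) m := by
    have := (Matrix.detRowAlternating (R := A) (n := Fin k)).toMultilinearMap.map_sum_finset
      (fun j m => (fun i : Fin k => t ^ (l j.succ - 1 - m) * x i.castSucc ^ m))
      (fun j : Fin k => Finset.Ico (l j.castSucc) (l j.succ))
    trans (Matrix.detRowAlternating (R := A) (n := Fin k)).toMultilinearMap
      (fun j => ∑ m ∈ Finset.Ico (l j.castSucc) (l j.succ),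
        (fun i : Fin k => t ^ (l j.succ - 1 - m) * x i.castSucc ^ m))
    · change Matrix.det _ = Matrix.det _
      congr 1
      ext j i
      simp only [Matrix.of_apply, Finset.sum_apply]
      exact Finset.sum_congr rfl fun m _ => mul_comm _ _
    · rw [this]
      refine Finset.sum_congr rfl fun m _ => ?_
      exact Matrix.det_mul_column (fun j => t ^ (l j.succ - 1 - m j))
        (Matrix.of fun j i => x i.castSucc ^ m j)
  rw [h3]
  -- Reversing the k differences cancels the cofactor sign (-1) ^ k.
  have h4 : ∏ i : Fin k, (t - x i.castSucc) = (-1) ^ k * ∏ i : Fin k, (x i.castSucc - t) := by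
    have : ∀ i : Fin k, t - x i.castSucc = (-1) * (x i.castSucc - t) := fun i => by ring
    simp_rw [this, Finset.prod_mul_distrib]
    simp
  rw [h4]
  simp only [B, Matrix.of_apply, Fin.cases_zero, ← ht, Fin.val_zero, Fin.val_last, zero_add]
  ring

/-! ### Complete homogeneous sums and the one-row bialternant formula -/

/-- The complete homogeneous symmetric polynomial evaluated at a family. -/
def hsum {ι : Type*} [Fintype ι] [DecidableEq ι] (x : ι → A) (m : ℕ) : A :=
  ∑ s : Sym ι m, (s.1.map x).prod

lemma hsum_zero {ι : Type*} [Fintype ι] [DecidableEq ι] (x : ι → A) : hsum x 0 = 1 := by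
  simp [hsum, Sym.eq_nil_of_card_zero]

lemma hsum_comp_equiv {ι κ : Type*} [Fintype ι] [DecidableEq ι] [Fintype κ] [DecidableEq κ]
    (e : ι ≃ κ) (x : κ → A) (m : ℕ) : hsum (x ∘ e) m = hsum x m := by
  refine Fintype.sum_equiv (Sym.equivCongr e) _ _ fun s => ?_
  simp [Sym.equivCongr]

lemma hsum_option_succ {ι : Type*} [Fintype ι] [DecidableEq ι] (x : Option ι → A) (m : ℕ) :
    hsum x (m + 1) = x none * hsum x m + hsum (x ∘ some) (m + 1) := by
  rw [hsum, ← Equiv.sum_comp symOptionSuccEquiv.symm, Fintype.sum_sum_type, hsum, hsum,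
    Finset.mul_sum]
  congr 1
  · refine Finset.sum_congr rfl fun s _ => ?_
    simp [symOptionSuccEquiv, SymOptionSuccEquiv.decode, Sym.coe_cons]
  · refine Finset.sum_congr rfl fun s _ => ?_
    simp [symOptionSuccEquiv, SymOptionSuccEquiv.decode]

lemma hsum_fin_succ (x : Fin (k + 1) → A) (m : ℕ) :
    hsum x (m + 1) = x (Fin.last k) * hsum x m +
      hsum (fun i : Fin k => x i.castSucc) (m + 1) := by
  rw [← hsum_comp_equiv finSuccEquivLast.symm, hsum_option_succ, hsum_comp_equiv]
  simp [Function.comp_def]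

lemma hsum_fin_sum (x : Fin (k + 1) → A) (m : ℕ) :
    hsum x m = ∑ i ∈ Finset.range (m + 1),
      x (Fin.last k) ^ (m - i) * hsum (fun i : Fin k => x i.castSucc) i := by
  induction m with
  | zero => simp [hsum_zero]
  | succ m ih =>
    rw [hsum_fin_succ, ih, Finset.sum_range_succ _ (m + 1), Finset.mul_sum]
    congr 1
    · refine Finset.sum_congr rfl fun i hi => ?_
      rw [Finset.mem_range] at hi
      rw [Nat.sub_add_comm (by omega), pow_succ]
      ring
    · simp

lemma alternant_staircase_succ (x : Fin (k + 1) → A) :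
    alternant x (fun j => (j : ℕ)) = (∏ i : Fin k, (x (Fin.last k) - x i.castSucc)) *
      alternant (fun i : Fin k => x i.castSucc) (fun j => (j : ℕ)) := by
  rw [alternant_succ x (l := fun j => (j : ℕ)) (fun a b h => h)]
  have : Fintype.piFinset (fun j : Fin k => Finset.Ico (j.castSucc : ℕ) (j.succ : ℕ)) =
      {fun j : Fin k => (j : ℕ)} := by
    ext m
    simp only [Fintype.mem_piFinset, Finset.mem_Ico, Finset.mem_singleton, funext_iff,
      Fin.val_castSucc, Fin.val_succ]
    exact forall_congr' fun j => by omega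
  rw [this]
  simp

/-- Induction on the number of variables: expanding both sides in the last variable t, the left by
h_m = ∑ t ^ (m - i) h_i(rest) and the right by branching, gives the same terms. -/
lemma hsum_mul_staircase (x : Fin (k + 1) → A) (m : ℕ) :
    hsum x m * alternant x (fun j => (j : ℕ)) =
      alternant x (Function.update (fun j => (j : ℕ)) (Fin.last k) (k + m)) := by
  induction k generalizing m with
  | zero =>
    have : ∀ m, hsum (fun i : Fin 0 => x i.castSucc) (m + 1) = 0 := fun m => by
      have : IsEmpty (Sym (Fin 0) (m + 1)) := inferInstance
      simp [hsum]
    rw [hsum_fin_sum, Finset.sum_range_succ']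
    simp [this, alternant, hsum_zero]
  | succ k ih =>
    have hm : Monotone (Function.update (fun j : Fin (k + 2) => (j : ℕ)) (Fin.last (k + 1))
        (k + 1 + m)) := by
      intro a b hab
      have hab' : (a : ℕ) ≤ b := hab
      by_cases ha : a = Fin.last (k + 1)
      · subst ha
        rw [Fin.last_le_iff] at hab
        simp [hab]
      · by_cases hb : b = Fin.last (k + 1)
        · subst hb
          have := a.is_lt
          simp only [Function.update_of_ne ha, Function.update_self]
          omega
        · simpa [ha, hb] using hab'
    rw [alternant_succ x hm, alternant_staircase_succ, hsum_fin_sum]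
    set L := Function.update (fun j : Fin (k + 2) => (j : ℕ)) (Fin.last (k + 1)) (k + 1 + m)
      with hL
    have hc : ∀ j : Fin (k + 1), L j.castSucc = j := fun j => by
      rw [hL, Function.update_of_ne (Fin.castSucc_ne_last j)]; rfl
    have hs : ∀ j : Fin (k + 1), j ≠ Fin.last k → L j.succ = j + 1 := fun j hj => by
      rw [hL, Function.update_of_ne (by rwa [← Fin.succ_last, Ne, Fin.succ_inj])]
      simp
    have hl : L (Fin.last k).succ = k + 1 + m := by
      rw [hL, Fin.succ_last, Function.update_self]
    have h0 : L 0 = 0 := by simpa using hc 0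
    rw [h0, pow_zero, mul_one, mul_left_comm]
    congr 1
    rw [Finset.sum_mul]
    -- All intervals but the last are singletons [j, j + 1), so an interlacing exponent vector is
    -- determined by its last entry k + i with i ≤ m.
    refine Finset.sum_nbij (fun i => Function.update (fun j => (j : ℕ)) (Fin.last k) (k + i))
      ?_ ?_ ?_ ?_
    · intro i hi
      rw [Finset.mem_range] at hi
      rw [Fintype.mem_piFinset]
      intro j
      rw [Finset.mem_Ico, hc]
      by_cases hj : j = Fin.last k
      · subst hj
        rw [hl, Function.update_self, Fin.val_last]
        omega
      · rw [hs j hj, Function.update_of_ne hj]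
        omega
    · intro i _ i' _ h
      have := congrFun h (Fin.last k)
      simpa using this
    · intro f hf
      rw [Finset.mem_coe, Fintype.mem_piFinset] at hf
      have hlast := hf (Fin.last k)
      rw [Finset.mem_Ico, hc, hl, Fin.val_last] at hlast
      refine ⟨f (Fin.last k) - k, by simp; omega, ?_⟩
      ext j
      by_cases hj : j = Fin.last k
      · subst hj
        simp only [Function.update_self]
        omega
      · have := hf j
        rw [Finset.mem_Ico, hc, hs j hj] at this
        simp only [Function.update_of_ne hj]
        omega
    · intro i hi
      rw [mul_assoc, ih, Fin.prod_univ_castSucc, hl, Function.update_self,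
        Finset.prod_eq_one, one_mul]
      · congr 2
        omega
      · intro j _
        have hj := Fin.castSucc_ne_last j
        rw [hs _ hj, Function.update_of_ne hj, Nat.add_sub_cancel, Nat.sub_self, pow_zero]

end Alternant

/-! ### Diagrams with at most k rows as strictly increasing exponent vectors -/

section YoungDiagram

/-- The exponents `μ_{k-j} + j` attached to a diagram with at most `k` rows, listed in
increasing order. -/
def shiftedRows (k : ℕ) (μ : YoungDiagram) (j : Fin k) : ℕ := μ.rowLen (k - 1 - j) + j

lemma shiftedRows_strictMono (k : ℕ) (μ : YoungDiagram) : StrictMono (shiftedRows k μ) := by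
  intro a b hab
  have := μ.rowLen_anti (k - 1 - b) (k - 1 - a) (by omega)
  have : (a : ℕ) < b := hab
  simp only [shiftedRows]
  omega

lemma youngDiagram_ext_rowLen {μ ν : YoungDiagram} (h : ∀ i, μ.rowLen i = ν.rowLen i) :
    μ = ν := by
  ext ⟨i, j⟩
  rw [YoungDiagram.mem_cells, YoungDiagram.mem_cells, YoungDiagram.mem_iff_lt_rowLen, h,
    YoungDiagram.mem_iff_lt_rowLen]

lemma rowLen_eq_zero_of_le {μ : YoungDiagram} {k i : ℕ} (hμ : μ.rowLen k = 0) (hi : k ≤ i) :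
    μ.rowLen i = 0 :=
  Nat.le_zero.1 ((μ.rowLen_anti k i hi).trans_eq hμ)

lemma shiftedRows_rev {k : ℕ} (μ : YoungDiagram) {i : ℕ} (hi : i < k) :
    shiftedRows k μ ⟨k - 1 - i, by omega⟩ = μ.rowLen i + (k - 1 - i) := by
  simp only [shiftedRows]
  congr 2
  omega

lemma shiftedRows_injective {k : ℕ} {μ ν : YoungDiagram} (hμ : μ.rowLen k = 0)
    (hν : ν.rowLen k = 0) (h : shiftedRows k μ = shiftedRows k ν) : μ = ν := by
  refine youngDiagram_ext_rowLen fun i => ?_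
  by_cases hi : i < k
  · have := congrFun h ⟨k - 1 - i, by omega⟩
    rw [shiftedRows_rev μ hi, shiftedRows_rev ν hi] at this
    omega
  · rw [rowLen_eq_zero_of_le hμ (by omega), rowLen_eq_zero_of_le hν (by omega)]

lemma exists_youngDiagram_rowLen {k : ℕ} {f : ℕ → ℕ} (hf : Antitone f) (hk : f k = 0) :
    ∃ μ : YoungDiagram, ∀ i, μ.rowLen i = f i := by
  let μ : YoungDiagram :=
    { cells := (Finset.range k ×ˢ Finset.range (f 0)).filter fun c => c.2 < f c.1
      isLowerSet := by
        rintro ⟨a, b⟩ ⟨c, d⟩ ⟨h1, h2⟩ h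
        simp only [Finset.coe_filter, Finset.mem_product, Finset.mem_range,
          Set.mem_ofPred_eq] at h h1 h2 ⊢
        have := hf h1
        omega }
  refine ⟨μ, fun i => eq_of_forall_lt_iff fun j => ?_⟩
  rw [← YoungDiagram.mem_iff_lt_rowLen]
  change (i, j) ∈ (Finset.range k ×ˢ Finset.range (f 0)).filter (fun c => c.2 < f c.1) ↔ _
  simp only [Finset.mem_filter, Finset.mem_product, Finset.mem_range, and_iff_right_iff_imp]
  intro h
  refine ⟨?_, h.trans_le (hf (Nat.zero_le i))⟩
  by_contra hi
  have := hf (not_lt.1 hi)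
  omega

lemma exists_shiftedRows_eq {k : ℕ} {l : Fin k → ℕ} (hl : StrictMono l) :
    ∃ μ : YoungDiagram, μ.rowLen k = 0 ∧ shiftedRows k μ = l := by
  -- Strict growth forces gaps of at least b - a, which makes the truncated subtractions in `f`
  -- exact and `f` antitone.
  have hstep : ∀ a b : Fin k, a ≤ b → l a + (b - a : ℕ) ≤ l b := by
    rintro ⟨a, ha⟩ ⟨b, hb⟩ hab
    obtain ⟨d, rfl⟩ := Nat.exists_eq_add_of_le (Fin.mk_le_mk.1 hab)
    induction d with
    | zero => simp
    | succ d ih =>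
      have h1 := ih (by omega) (by simp)
      have h2 : l ⟨a + d, by omega⟩ < l ⟨a + (d + 1), hb⟩ := hl (Fin.mk_lt_mk.2 (by omega))
      simp only at h1 ⊢
      omega
  let f : ℕ → ℕ := fun i => if h : i < k then l ⟨k - 1 - i, by omega⟩ - (k - 1 - i) else 0
  have hf : Antitone f := by
    intro a b hab
    simp only [f]
    split_ifs with h1 h2
    · have := hstep ⟨k - 1 - b, by omega⟩ ⟨k - 1 - a, by omega⟩ (Fin.mk_le_mk.2 (by omega))
      simp only at this
      omega
    · omega
    · exact Nat.zero_le _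
    · exact le_rfl
  obtain ⟨μ, hμ⟩ := exists_youngDiagram_rowLen (k := k) hf (by simp [f])
  refine ⟨μ, by simp [hμ, f], ?_⟩
  ext ⟨j, hj⟩
  have := hstep ⟨0, by omega⟩ ⟨j, hj⟩ (Fin.mk_le_mk.2 (by omega))
  simp only [Nat.sub_zero] at this
  have e : k - 1 - (k - 1 - j) = j := by omega
  simp only [shiftedRows, hμ, f, e]
  rw [dif_pos (by omega)]
  omega

lemma card_cells_eq_sum {k : ℕ} {μ : YoungDiagram} (hμ : μ.rowLen k = 0) :
    μ.cells.card = ∑ i ∈ Finset.range k, μ.rowLen i := by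
  rw [Finset.card_eq_sum_card_fiberwise (f := Prod.fst) (t := Finset.range k)]
  · refine Finset.sum_congr rfl fun i _ => ?_
    rw [YoungDiagram.rowLen_eq_card]
    rfl
  · rintro ⟨i, j⟩ h
    rw [Finset.mem_coe, YoungDiagram.mem_cells, YoungDiagram.mem_iff_lt_rowLen] at h
    simp only [Finset.coe_range, Set.mem_Iio]
    by_contra hi
    have := rowLen_eq_zero_of_le hμ (not_lt.1 hi)
    omega

lemma card_cells_add_sum {k : ℕ} {μ : YoungDiagram} (hμ : μ.rowLen k = 0) :
    μ.cells.card + ∑ j : Fin k, (j : ℕ) = ∑ j, shiftedRows k μ j := by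
  simp only [shiftedRows, Finset.sum_add_distrib]
  rw [card_cells_eq_sum hμ, ← Finset.sum_range_reflect, Finset.sum_range]

end YoungDiagram

/-! ### Branching of tableaux and the bialternant formula -/

section SchurSum

variable {A : Type*} [CommRing A] {k : ℕ}

/-- A family indexed by `Fin k`, extended by zero to `ℕ`. -/
def extendZero (x : Fin k → A) (v : ℕ) : A := if h : v < k then x ⟨v, h⟩ else 0

/-- The Schur polynomial of shape `μ` evaluated at a family. -/
noncomputable def schurSum (x : Fin k → A) (μ : YoungDiagram) : A :=
  ∑ T : BoundedSSYT k μ, ∏ c ∈ μ.cells, extendZero x (T.1 c.1 c.2)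

lemma schurPolynomial_eq_schurSum (R : Type*) [CommRing R] (μ : YoungDiagram) :
    schurPolynomial k R μ = schurSum (X : Fin k → MvPolynomial (Fin k) R) μ := by
  refine Finset.sum_congr rfl fun T _ => ?_
  rw [← Finset.prod_coe_sort μ.cells (fun c => extendZero X (T.1 c.1 c.2))]
  refine Finset.prod_congr rfl fun c _ => ?_
  rw [extendZero, dif_pos (T.2 c.1 c.2)]

/-- `ν` interlaces `μ`, i.e. the skew shape `μ / ν` is a horizontal strip. -/
def Interlaces (ν μ : YoungDiagram) : Prop :=
  ∀ i, μ.rowLen (i + 1) ≤ ν.rowLen i ∧ ν.rowLen i ≤ μ.rowLen i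

lemma Interlaces.le {ν μ : YoungDiagram} (h : Interlaces ν μ) : ν ≤ μ := by
  rintro ⟨i, j⟩ hc
  rw [YoungDiagram.mem_iff_lt_rowLen] at hc ⊢
  exact hc.trans_le (h i).2

lemma Interlaces.mem_of_succ {ν μ : YoungDiagram} (h : Interlaces ν μ) {i i' j : ℕ}
    (hi : i < i') (hc : (i', j) ∈ μ) : (i, j) ∈ ν := by
  have := μ.up_left_mem (Nat.succ_le_of_lt hi) le_rfl hc
  rw [YoungDiagram.mem_iff_lt_rowLen] at this ⊢
  exact this.trans_le (h i).1

/-- Filling a horizontal strip with the new largest letter. -/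
def BoundedSSYT.extend {ν μ : YoungDiagram} (h : Interlaces ν μ) (T : BoundedSSYT k ν) :
    BoundedSSYT (k + 1) μ where
  val :=
    { entry := fun i j => if (i, j) ∈ ν then T.1 i j else if (i, j) ∈ μ then k else 0
      row_weak' := by
        intro i j1 j2 hj hc
        have hc' := μ.up_left_mem le_rfl hj.le hc
        by_cases h2 : (i, j2) ∈ ν
        · rw [if_pos h2, if_pos (ν.up_left_mem le_rfl hj.le h2)]
          exact T.1.row_weak hj h2
        · rw [if_neg h2, if_pos hc, if_pos hc']
          split_ifs with h1
          · exact (T.2 _ h1).le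
          · exact le_rfl
      col_strict' := by
        intro i1 i2 j hi hc
        have h1 := h.mem_of_succ hi hc
        rw [if_pos h1]
        split_ifs with h2
        · exact T.1.col_strict hi h2
        · exact T.2 _ h1
      zeros' := by
        intro i j hc
        rw [if_neg (fun h1 => hc (h.le h1)), if_neg hc] }
  property := by
    rintro ⟨i, j⟩ hc
    change (if (i, j) ∈ ν then T.1 i j else if (i, j) ∈ μ then k else 0) < k + 1
    split_ifs with h1
    · exact (T.2 _ h1).trans (Nat.lt_succ_self k)
    · omega
    · omega

lemma BoundedSSYT.extend_apply {ν μ : YoungDiagram} (h : Interlaces ν μ) (T : BoundedSSYT k ν)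
    (i j : ℕ) : (T.extend h).1 i j = if (i, j) ∈ ν then T.1 i j else if (i, j) ∈ μ then k else 0 :=
  rfl

lemma BoundedSSYT.mem_iff_extend_lt {ν μ : YoungDiagram} (h : Interlaces ν μ)
    (T : BoundedSSYT k ν) (c : ℕ × ℕ) :
    c ∈ ν ↔ c ∈ μ ∧ (T.extend h).1 c.1 c.2 < k := by
  rw [extend_apply]
  constructor
  · intro hc
    rw [if_pos hc]
    exact ⟨h.le hc, T.2 _ hc⟩
  · rintro ⟨h1, h2⟩
    by_contra hc
    rw [if_neg hc, if_pos h1] at h2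
    exact lt_irrefl _ h2

lemma BoundedSSYT.exists_extend {μ : YoungDiagram} (T : BoundedSSYT (k + 1) μ) :
    ∃ (ν : YoungDiagram) (h : Interlaces ν μ) (T' : BoundedSSYT k ν),
      ν.rowLen k = 0 ∧ T'.extend h = T := by
  let ν : YoungDiagram :=
    { cells := μ.cells.filter fun c => T.1 c.1 c.2 < k
      isLowerSet := by
        rintro ⟨a, b⟩ ⟨c, d⟩ ⟨h1, h2⟩ h
        simp only [Finset.coe_filter, YoungDiagram.mem_cells, Set.mem_ofPred_eq] at h h1 h2 ⊢
        refine ⟨μ.up_left_mem h1 h2 h.1, ?_⟩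
        exact ((T.1.col_weak h1 (μ.up_left_mem le_rfl h2 h.1)).trans
          (T.1.row_weak_of_le h2 h.1)).trans_lt h.2 }
  have hν : ∀ i j, (i, j) ∈ ν ↔ (i, j) ∈ μ ∧ T.1 i j < k := fun i j => by
    change (i, j) ∈ μ.cells.filter (fun c => T.1 c.1 c.2 < k) ↔ _
    simp
  have h : Interlaces ν μ := by
    intro i
    constructor
    · refine le_of_forall_lt fun j hj => ?_
      rw [← YoungDiagram.mem_iff_lt_rowLen] at hj ⊢
      rw [hν]
      have h1 := T.1.col_strict (Nat.lt_add_one i) hj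
      have h2 := T.2 _ hj
      exact ⟨μ.up_left_mem (Nat.le_succ i) le_rfl hj, by simp only at h2; omega⟩
    · refine le_of_forall_lt fun j hj => ?_
      rw [← YoungDiagram.mem_iff_lt_rowLen] at hj ⊢
      exact ((hν i j).1 hj).1
  have hk : ν.rowLen k = 0 := by
    by_contra hne
    have hm : (k, 0) ∈ ν := YoungDiagram.mem_iff_lt_rowLen.2 (Nat.pos_of_ne_zero hne)
    rw [hν] at hm
    -- Columns increase strictly from row 0, so an entry in row k is at least k and cannot survive
    -- in `ν`.
    have hle : ∀ i, i ≤ k → i ≤ T.1 i 0 := by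
      intro i
      induction i with
      | zero => simp
      | succ i ih =>
        intro hi
        have := T.1.col_strict (Nat.lt_add_one i) (μ.up_left_mem hi le_rfl hm.1)
        have := ih (by omega)
        omega
    have := hle k le_rfl
    omega
  let T' : BoundedSSYT k ν :=
    { val :=
        { entry := fun i j => if (i, j) ∈ ν then T.1 i j else 0
          row_weak' := by
            intro i j1 j2 hj hc
            rw [if_pos hc, if_pos (ν.up_left_mem le_rfl hj.le hc)]
            exact T.1.row_weak hj (h.le hc)
          col_strict' := by
            intro i1 i2 j hi hc
            rw [if_pos hc, if_pos (ν.up_left_mem hi.le le_rfl hc)]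
            exact T.1.col_strict hi (h.le hc)
          zeros' := fun hc => if_neg hc }
      property := by
        rintro ⟨i, j⟩ hc
        change (if (i, j) ∈ ν then T.1 i j else 0) < k
        rw [YoungDiagram.mem_cells] at hc
        rw [if_pos hc]
        exact ((hν i j).1 hc).2 }
  refine ⟨ν, h, T', hk, Subtype.ext (SemistandardYoungTableau.ext fun i j => ?_)⟩
  rw [BoundedSSYT.extend_apply]
  split_ifs with h1 h2
  · change (if (i, j) ∈ ν then T.1 i j else 0) = _
    rw [if_pos h1]
  · have := T.2 _ h2
    rw [hν, not_and] at h1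
    have := h1 h2
    simp only at *
    omega
  · rw [T.1.zeros h2]

lemma prod_extend (x : Fin (k + 1) → A) {ν μ : YoungDiagram} (h : Interlaces ν μ)
    (T : BoundedSSYT k ν) :
    ∏ c ∈ μ.cells, extendZero x ((T.extend h).1 c.1 c.2) =
      x (Fin.last k) ^ (μ.cells.card - ν.cells.card) *
        ∏ c ∈ ν.cells, extendZero (fun i : Fin k => x i.castSucc) (T.1 c.1 c.2) := by
  have hsub : ν.cells ⊆ μ.cells := h.le
  rw [← Finset.prod_sdiff hsub, ← Finset.card_sdiff_of_subset hsub]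
  congr 1
  · refine Finset.prod_eq_pow_card fun c hc => ?_
    rw [Finset.mem_sdiff, YoungDiagram.mem_cells, YoungDiagram.mem_cells] at hc
    rw [BoundedSSYT.extend_apply, if_neg hc.2, if_pos hc.1, extendZero,
      dif_pos (Nat.lt_succ_self k)]
    rfl
  · refine Finset.prod_congr rfl fun c hc => ?_
    have := T.2 c hc
    rw [YoungDiagram.mem_cells] at hc
    rw [BoundedSSYT.extend_apply, if_pos hc, extendZero, extendZero, dif_pos this,
      dif_pos (by omega)]
    rfl

lemma strictMono_of_mem_piFinset_Ico {l : Fin (k + 1) → ℕ} (hl : Monotone l) {m : Fin k → ℕ}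
    (hm : m ∈ Fintype.piFinset fun j : Fin k => Finset.Ico (l j.castSucc) (l j.succ)) :
    StrictMono m := by
  intro a b hab
  rw [Fintype.mem_piFinset] at hm
  have h1 := Finset.mem_Ico.1 (hm a)
  have h2 := Finset.mem_Ico.1 (hm b)
  have h3 := hl (show a.succ ≤ b.castSucc from Fin.le_def.2 (by simpa using hab))
  omega

/-- After the shift, the weak inequalities of interlacing become independent half-open intervals,
the same index set as in `alternant_succ`; this lets the two branching rules be compared term by
term. -/
lemma interlaces_iff_shiftedRows {ν μ : YoungDiagram} (hμ : μ.rowLen (k + 1) = 0)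
    (hν : ν.rowLen k = 0) :
    Interlaces ν μ ↔ shiftedRows k ν ∈ Fintype.piFinset fun j : Fin k =>
      Finset.Ico (shiftedRows (k + 1) μ j.castSucc) (shiftedRows (k + 1) μ j.succ) := by
  have e1 : ∀ j : Fin k, shiftedRows (k + 1) μ j.castSucc = μ.rowLen (k - 1 - j + 1) + j := by
    intro j
    simp only [shiftedRows, Fin.val_castSucc]
    congr 2
    omega
  have e2 : ∀ j : Fin k, shiftedRows (k + 1) μ j.succ = μ.rowLen (k - 1 - j) + j + 1 := by
    intro j
    simp only [shiftedRows, Fin.val_succ]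
    rw [add_assoc]
    congr 2
    omega
  simp only [Fintype.mem_piFinset, Finset.mem_Ico, e1, e2]
  simp only [shiftedRows]
  constructor
  · intro h j
    have := h (k - 1 - j)
    omega
  · intro h i
    by_cases hi : i < k
    · have := h ⟨k - 1 - i, by omega⟩
      have e : k - 1 - (k - 1 - i) = i := by omega
      simp only [e] at this
      omega
    · rw [rowLen_eq_zero_of_le hμ (by omega), rowLen_eq_zero_of_le hν (by omega)]
      omega

lemma card_sub_card_of_interlaces {ν μ : YoungDiagram} (hμ : μ.rowLen (k + 1) = 0)
    (hν : ν.rowLen k = 0) (h : Interlaces ν μ) :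
    μ.cells.card - ν.cells.card = shiftedRows (k + 1) μ 0 +
      ∑ j : Fin k, (shiftedRows (k + 1) μ j.succ - 1 - shiftedRows k ν j) := by
  have h1 := card_cells_add_sum hμ
  have h2 := card_cells_add_sum hν
  have h3 : ∑ j : Fin k, (shiftedRows (k + 1) μ j.succ - 1 - shiftedRows k ν j) +
      ∑ j, shiftedRows k ν j + k = ∑ j : Fin k, shiftedRows (k + 1) μ j.succ := by
    rw [interlaces_iff_shiftedRows hμ hν, Fintype.mem_piFinset] at h
    have : ∑ j : Fin k, 1 = k := by simp
    rw [← Finset.sum_add_distrib]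
    refine (congrArg (_ + ·) this.symm).trans ?_
    rw [← Finset.sum_add_distrib]
    refine Finset.sum_congr rfl fun j _ => ?_
    have := Finset.mem_Ico.1 (h j)
    omega
  rw [Fin.sum_univ_castSucc, Fin.sum_univ_succ (shiftedRows (k + 1) μ)] at h1
  simp only [Fin.val_castSucc, Fin.val_last] at h1
  omega

/-- Branching of Schur polynomials: removing the last variable. -/
lemma schurSum_succ (x : Fin (k + 1) → A) {μ : YoungDiagram} (hμ : μ.rowLen (k + 1) = 0)
    (ν : (Fin k → ℕ) → YoungDiagram)
    (hν : ∀ m, StrictMono m → (ν m).rowLen k = 0 ∧ shiftedRows k (ν m) = m) :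
    schurSum x μ = x (Fin.last k) ^ shiftedRows (k + 1) μ 0 *
      ∑ m ∈ Fintype.piFinset (fun j : Fin k =>
          Finset.Ico (shiftedRows (k + 1) μ j.castSucc) (shiftedRows (k + 1) μ j.succ)),
        (∏ j : Fin k, x (Fin.last k) ^ (shiftedRows (k + 1) μ j.succ - 1 - m j)) *
          schurSum (fun i : Fin k => x i.castSucc) (ν m) := by
  set P := Fintype.piFinset (fun j : Fin k =>
    Finset.Ico (shiftedRows (k + 1) μ j.castSucc) (shiftedRows (k + 1) μ j.succ)) with hP
  have hmono : ∀ m ∈ P, StrictMono m := fun m hm =>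
    strictMono_of_mem_piFinset_Ico (shiftedRows_strictMono (k + 1) μ).monotone hm
  have hint : ∀ m ∈ P, Interlaces (ν m) μ := by
    intro m hm
    have := hν m (hmono m hm)
    rw [interlaces_iff_shiftedRows hμ this.1, this.2]
    exact hm
  let E : (Σ m : P, BoundedSSYT k (ν m)) → BoundedSSYT (k + 1) μ :=
    fun p => p.2.extend (hint p.1 p.1.2)
  have hE : Function.Bijective E := by
    constructor
    · rintro ⟨⟨m, hm⟩, T⟩ ⟨⟨m', hm'⟩, T'⟩ h
      have hmm : ν m = ν m' := by
        ext c
        rw [YoungDiagram.mem_cells, YoungDiagram.mem_cells,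
          BoundedSSYT.mem_iff_extend_lt (hint m hm) T,
          BoundedSSYT.mem_iff_extend_lt (hint m' hm') T']
        have h' : T.extend (hint m hm) = T'.extend (hint m' hm') := h
        rw [h']
      have : m = m' := by
        rw [← (hν m (hmono m hm)).2, ← (hν m' (hmono m' hm')).2, hmm]
      subst this
      congr 1
      refine Subtype.ext (SemistandardYoungTableau.ext fun i j => ?_)
      by_cases hc : (i, j) ∈ ν m
      · have h' : T.extend (hint m hm) = T'.extend (hint m hm) := h
        have := congrArg (fun S : BoundedSSYT (k + 1) μ => S.1 i j) h'
        simpa only [BoundedSSYT.extend_apply, if_pos hc] using this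
      · rw [T.1.zeros hc, T'.1.zeros hc]
    · intro T
      obtain ⟨ν', h, T', hk, rfl⟩ := T.exists_extend
      have hm := (interlaces_iff_shiftedRows hμ hk).1 h
      have := hν _ (hmono _ hm)
      have hνν := shiftedRows_injective this.1 hk this.2
      generalize shiftedRows k ν' = m at hm hνν
      subst hνν
      exact ⟨⟨⟨m, hm⟩, T'⟩, rfl⟩
  rw [schurSum, ← Fintype.sum_bijective E hE _ _ (fun p => rfl), Fintype.sum_sigma,
    Finset.mul_sum, ← Finset.sum_coe_sort P]
  refine Finset.sum_congr rfl fun m _ => ?_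
  have hm := hν m.1 (hmono m.1 m.2)
  rw [schurSum, Finset.mul_sum, Finset.mul_sum]
  refine Finset.sum_congr rfl fun T _ => ?_
  rw [prod_extend, card_sub_card_of_interlaces hμ hm.1 (hint m.1 m.2), hm.2, pow_add,
    ← Finset.prod_pow_eq_pow_sum, mul_assoc]

/-- The bialternant formula. -/
theorem schurSum_mul_staircase (x : Fin k → A) {μ : YoungDiagram} (hμ : μ.rowLen k = 0) :
    schurSum x μ * alternant x (fun j => (j : ℕ)) = alternant x (shiftedRows k μ) := by
  induction k generalizing μ with
  | zero =>
    have : μ = ⊥ := by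
      refine youngDiagram_ext_rowLen fun i => ?_
      rw [rowLen_eq_zero_of_le hμ (Nat.zero_le i)]
      refine (Nat.eq_zero_of_not_pos fun h => ?_).symm
      exact YoungDiagram.notMem_bot _ (YoungDiagram.mem_iff_lt_rowLen.2 h)
    subst this
    have : Unique (BoundedSSYT 0 ⊥) :=
      { default := ⟨default, fun c hc => absurd hc (Finset.notMem_empty c)⟩
        uniq := fun T => Subtype.ext (SemistandardYoungTableau.ext fun i j => by
          rw [T.1.zeros (YoungDiagram.notMem_bot _),
            SemistandardYoungTableau.zeros _ (YoungDiagram.notMem_bot _)]) }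
    simp [schurSum, alternant]
  | succ k ih =>
    choose! ν hν using fun (m : Fin k → ℕ) (hm : StrictMono m) => exists_shiftedRows_eq hm
    rw [schurSum_succ x hμ ν hν, alternant_staircase_succ,
      alternant_succ x (shiftedRows_strictMono _ _).monotone, mul_mul_mul_comm,
      mul_comm (x _ ^ _)]
    congr 1
    rw [Finset.sum_mul]
    refine Finset.sum_congr rfl fun m hm => ?_
    have := hν m (strictMono_of_mem_piFinset_Ico (shiftedRows_strictMono _ _).monotone hm)
    rw [mul_assoc, ih _ this.1, this.2]

end SchurSum

/-! ### Alternants in the polynomial ring and symmetry of Schur polynomials -/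

section PolynomialAlternant

variable {R : Type*} [CommRing R] {k : ℕ}

/-- The base ring may have zero divisors, so regularity is checked on coefficients: X_i f = X_j f
moves a coefficient to one with a smaller exponent of X_j, until that exponent is 0 and the
coefficient vanishes. -/
lemma MvPolynomial.isRegular_X_sub_X {σ : Type*} {i j : σ} (hij : i ≠ j) :
    IsRegular (X i - X j : MvPolynomial σ R) := by
  classical
  rw [← isLeftRegular_iff_isRegular, isLeftRegular_iff_right_eq_zero_of_mul]
  intro f hf
  rw [sub_mul, sub_eq_zero] at hf
  have key : ∀ (d : ℕ) (m : σ →₀ ℕ), m j = d → coeff m f = 0 := by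
    intro d
    induction d with
    | zero =>
      intro m hm
      rw [← coeff_X_mul m i f, hf, coeff_X_mul', if_neg]
      simp [hm, hij]
    | succ d ih =>
      intro m hm
      rw [← coeff_X_mul m i f, hf, coeff_X_mul', if_pos]
      · refine ih _ ?_
        simp [hm, hij]
      · simp [hm, hij]
  ext m
  rw [key _ m rfl, coeff_zero]

lemma isRegular_staircase : IsRegular
    (alternant (X : Fin k → MvPolynomial (Fin k) R) (fun j => (j : ℕ))) := by
  rw [alternant_staircase]
  exact IsRegular.prod fun i _ => IsRegular.prod fun j hj =>
    isRegular_X_sub_X (Finset.mem_Ioi.1 hj).ne'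

lemma alternant_X_eq_sum (g : Fin k →₀ ℕ) :
    alternant (X : Fin k → MvPolynomial (Fin k) R) g =
      ∑ σ : Equiv.Perm (Fin k), (Equiv.Perm.sign σ : ℤ) • rename σ (monomial g (1 : R)) := by
  rw [alternant, ← Matrix.det_transpose, Matrix.det_apply]
  refine Finset.sum_congr rfl fun σ _ => ?_
  rw [Units.smul_def]
  congr 1
  rw [monomial_eq, C_1, one_mul, Finsupp.prod_fintype _ _ (fun i => pow_zero _), map_prod]
  simp

/-- Multiplication of an alternant by a symmetric polynomial. -/
lemma MvPolynomial.IsSymmetric.mul_alternant {f : MvPolynomial (Fin k) R} (hf : f.IsSymmetric)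
    (g : Fin k →₀ ℕ) :
    f * alternant X g = ∑ m ∈ f.support, coeff m f • alternant X ⇑(m + g) := by
  have h1 : ∀ σ : Equiv.Perm (Fin k), f * rename σ (monomial g (1 : R)) =
      ∑ m ∈ f.support, coeff m f • rename σ (monomial (m + g) 1) := by
    intro σ
    -- Invariance of f lets it enter the renaming, where it multiplies a single monomial.
    nth_rw 1 [← hf σ]
    rw [← map_mul]
    nth_rw 1 [f.as_sum]
    rw [Finset.sum_mul, map_sum]
    refine Finset.sum_congr rfl fun m _ => ?_
    rw [monomial_mul, mul_one, ← map_smul, smul_monomial, smul_eq_mul, mul_one]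
  have h2 : ∀ m : Fin k →₀ ℕ, alternant (X : Fin k → MvPolynomial (Fin k) R) ⇑(m + g) =
      ∑ σ : Equiv.Perm (Fin k), (Equiv.Perm.sign σ : ℤ) • rename σ (monomial (m + g) (1 : R)) :=
    fun m => alternant_X_eq_sum (m + g)
  simp only [h2, Finset.smul_sum]
  rw [alternant_X_eq_sum, Finset.mul_sum, Finset.sum_comm]
  refine Finset.sum_congr rfl fun σ _ => ?_
  rw [mul_smul_comm, h1, Finset.smul_sum]
  exact Finset.sum_congr rfl fun m _ => smul_comm _ _ _

lemma rename_alternant (σ : Equiv.Perm (Fin k)) (l : Fin k → ℕ) :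
    rename σ (alternant (X : Fin k → MvPolynomial (Fin k) R) l) =
      ((Equiv.Perm.sign σ : ℤ) : MvPolynomial (Fin k) R) * alternant X l := by
  rw [map_alternant]
  simp only [rename_X]
  exact Matrix.det_permute' σ (Matrix.of fun j i => (X i : MvPolynomial (Fin k) R) ^ l j)

/-- Both alternants in the bialternant formula change by the same sign, and δ can be cancelled. -/
lemma isSymmetric_schurSum {μ : YoungDiagram} (hμ : μ.rowLen k = 0) :
    (schurSum (X : Fin k → MvPolynomial (Fin k) R) μ).IsSymmetric := by
  intro σ
  have h := congrArg (rename σ) (schurSum_mul_staircase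
    (X : Fin k → MvPolynomial (Fin k) R) hμ)
  rw [map_mul, rename_alternant, rename_alternant, ← schurSum_mul_staircase _ hμ,
    mul_left_comm] at h
  have hu : IsUnit ((Equiv.Perm.sign σ : ℤ) : MvPolynomial (Fin k) R) :=
    (Equiv.Perm.sign σ).isUnit.map (Int.castRingHom (MvPolynomial (Fin k) R))
  exact isRegular_staircase.right (hu.mul_left_cancel h)

lemma isHomogeneous_schurSum (μ : YoungDiagram) :
    (schurSum (X : Fin k → MvPolynomial (Fin k) R) μ).IsHomogeneous μ.cells.card := by
  refine IsHomogeneous.sum _ _ _ fun T _ => ?_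
  rw [Finset.card_eq_sum_ones]
  refine IsHomogeneous.prod _ _ _ fun c hc => ?_
  rw [extendZero, dif_pos (T.2 c hc)]
  exact isHomogeneous_X _ _

lemma hsymm_eq_hsum (m : ℕ) : hsymm (Fin k) R m = hsum (X : Fin k → MvPolynomial (Fin k) R) m :=
  rfl

lemma isHomogeneous_hsymm (σ : Type*) [Fintype σ] [DecidableEq σ] (m : ℕ) :
    (hsymm σ R m).IsHomogeneous m := by
  refine IsHomogeneous.sum _ _ _ fun s _ => ?_
  have : ∀ t : Multiset σ, ((t.map X).prod : MvPolynomial σ R).IsHomogeneous t.card := by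
    intro t
    induction t using Multiset.induction_on with
    | empty => simpa using isHomogeneous_one σ R
    | cons a t ih =>
      rw [Multiset.map_cons, Multiset.prod_cons, Multiset.card_cons, add_comm]
      exact (isHomogeneous_X R a).mul ih
  simpa using this s.1

/-! ### The relation for x_r ^ n and the complete homogeneous polynomials -/

/-- Powers of the `x_r` are combinations of the first `k` ones. -/
lemma exists_pow_eq_sum {A : Type*} [CommRing A] (x : Fin k → A) (n : ℕ) :
    ∃ z : Fin k → A, ∀ r, x r ^ n = ∑ c, z c * x r ^ (c : ℕ) := by
  nontriviality A
  let E : Polynomial A := ∏ i, (Polynomial.X - Polynomial.C (x i))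
  have hE : E.Monic := Polynomial.monic_prod_of_monic _ _ fun i _ => Polynomial.monic_X_sub_C _
  have hdeg : E.natDegree = k := by
    rw [Polynomial.natDegree_prod_of_monic _ _ fun i _ => Polynomial.monic_X_sub_C _]
    simp
  refine ⟨fun c => (Polynomial.X ^ n %ₘ E).coeff c, fun r => ?_⟩
  have hr : E.eval (x r) = 0 := by
    rw [Polynomial.eval_prod]
    exact Finset.prod_eq_zero (Finset.mem_univ r) (by simp)
  have h := congrArg (Polynomial.eval (x r)) (Polynomial.modByMonic_add_div (Polynomial.X ^ n) E)
  rw [Polynomial.eval_add, Polynomial.eval_mul, hr, zero_mul, add_zero, Polynomial.eval_pow,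
    Polynomial.eval_X] at h
  rw [← h, Polynomial.eval_eq_sum_range' (n := k), Finset.sum_range]
  by_cases hk : k = 0
  · subst hk; exact r.elim0
  · rw [← hdeg]
    refine Polynomial.natDegree_modByMonic_lt _ hE fun h1 => hk ?_
    rw [← hdeg, h1, Polynomial.natDegree_one]

/-- Multiply by δ: the left side becomes the staircase with last exponent i + n, which the relation
lowers to exponents i + c. Reversing the index of y makes the result lower triangular. -/
lemma hsum_eq_sum_of_pow_eq {n : ℕ} (hkn : k ≤ n) {y : Fin k → MvPolynomial (Fin k) R}
    (hy : ∀ r, (X r : MvPolynomial (Fin k) R) ^ n = ∑ c : Fin k, y c.rev * X r ^ (c : ℕ))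
    (i : Fin k) :
    hsum (X : Fin k → MvPolynomial (Fin k) R) (n - k + (i + 1)) =
      ∑ j ∈ Finset.Iic i, hsum (X : Fin k → MvPolynomial (Fin k) R) (i - j) * y j := by
  obtain _ | k := k
  · exact i.elim0
  refine isRegular_staircase.right ?_
  simp only
  rw [hsum_mul_staircase, Finset.sum_mul]
  have e : k + (n - (k + 1) + ((i : ℕ) + 1)) = i + n := by omega
  rw [e, alternant_update_reduce hy, ← Equiv.sum_comp Fin.revPerm]
  simp only [Fin.revPerm_apply, Fin.rev_rev]
  rw [← Finset.sum_subset (Finset.subset_univ (Finset.Iic i))]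
  · refine Finset.sum_congr rfl fun j hj => ?_
    rw [Finset.mem_Iic, Fin.le_def] at hj
    rw [mul_right_comm, hsum_mul_staircase, mul_comm, Fin.val_rev]
    congr 3
    omega
  · intro j _ hj
    rw [Finset.mem_Iic, Fin.le_def, not_le] at hj
    rw [alternant_eq_zero_of_not_injective, mul_zero]
    intro hinj
    -- For j > i the lowered last exponent repeats an earlier staircase exponent, so the alternant
    -- vanishes.
    have hlt : (i : ℕ) + (j.rev : ℕ) < k := by rw [Fin.val_rev]; omega
    have := @hinj (Fin.last k) ⟨i + j.rev, by omega⟩ (by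
      rw [Function.update_self, Function.update_of_ne (by
        rw [Ne, Fin.ext_iff, Fin.val_last]; exact hlt.ne)])
    rw [Fin.ext_iff, Fin.val_last] at this
    exact hlt.ne' this

end PolynomialAlternant

/-! ### Unitriangular systems over a commutative ring -/

section TriangularSolve

variable {A : Type*} [CommRing A] {k : ℕ}

/-- The solution `w` of the unitriangular system `∑ j < i, c (i - j) * w j + w i = g i`. -/
def triangularSolve (c : ℕ → A) (g : Fin k → A) (i : Fin k) : A :=
  g i - ∑ j ∈ (Finset.Iio i).attach, c (i - j.1) * triangularSolve c g j.1
termination_by i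
decreasing_by exact Fin.lt_def.1 (Finset.mem_Iio.1 j.2)

lemma triangularSolve_eq (c : ℕ → A) (g : Fin k → A) (i : Fin k) :
    triangularSolve c g i = g i - ∑ j ∈ Finset.Iio i, c (i - j) * triangularSolve c g j := by
  rw [triangularSolve, Finset.sum_attach _ fun j : Fin k => c (i - j) * triangularSolve c g j]

lemma eq_triangularSolve {c : ℕ → A} {g w : Fin k → A}
    (hw : ∀ i, g i = ∑ j ∈ Finset.Iio i, c (i - j) * w j + w i) :
    w = triangularSolve c g := by
  ext i
  induction i using WellFoundedLT.induction with
  | ind i ih =>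
    rw [triangularSolve_eq, hw i, Finset.sum_congr rfl fun j hj => by
      rw [ih j (Finset.mem_Iio.1 hj)]]
    ring

lemma map_triangularSolve {B F : Type*} [CommRing B] [FunLike F A B] [RingHomClass F A B] (f : F)
    (c : ℕ → A) (g : Fin k → A) (i : Fin k) :
    f (triangularSolve c g i) = triangularSolve (fun m => f (c m)) (fun i => f (g i)) i := by
  revert i
  refine congrFun (eq_triangularSolve fun i => ?_)
  conv_lhs => rw [← sub_add_cancel (g i) (∑ j ∈ Finset.Iio i, c (i - j) * triangularSolve c g j),
    ← triangularSolve_eq]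
  rw [map_add, map_sum, add_comm]
  simp only [map_mul]

lemma span_range_triangularSolve (c : ℕ → A) (g : Fin k → A) :
    Ideal.span (Set.range (triangularSolve c g)) = Ideal.span (Set.range g) := by
  refine le_antisymm (Ideal.span_le.2 ?_) (Ideal.span_le.2 ?_)
  · rintro _ ⟨i, rfl⟩
    induction i using WellFoundedLT.induction with
    | ind i ih =>
      rw [triangularSolve_eq]
      exact sub_mem (Ideal.subset_span ⟨i, rfl⟩) (sum_mem fun j hj =>
        Ideal.mul_mem_left _ _ (ih j (Finset.mem_Iio.1 hj)))
  · rintro _ ⟨i, rfl⟩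
    rw [← sub_add_cancel (g i) (∑ j ∈ Finset.Iio i, c (i - j) * triangularSolve c g j),
      ← triangularSolve_eq]
    exact add_mem (Ideal.subset_span ⟨i, rfl⟩) (sum_mem fun j _ =>
      Ideal.mul_mem_left _ _ (Ideal.subset_span ⟨j, rfl⟩))

end TriangularSolve

/-! ### Independence over the ring generated by the coefficients y -/

section Independence

variable {B : Type*} [CommRing B] {k : ℕ}

/-- The polynomial `X ^ n - ∑ z_c X ^ c`. -/
noncomputable def monicOfLower (n : ℕ) (z : Fin k → B) : Polynomial B :=
  Polynomial.X ^ n - ∑ c, Polynomial.C (z c) * Polynomial.X ^ (c : ℕ)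

lemma monicOfLower_degree_lt {n : ℕ} (hkn : k ≤ n) (z : Fin k → B) :
    (∑ c, Polynomial.C (z c) * Polynomial.X ^ (c : ℕ) : Polynomial B).degree < (n : WithBot ℕ) := by
  refine lt_of_le_of_lt (Polynomial.degree_sum_le _ _) ((Finset.sup_lt_iff
    (WithBot.bot_lt_coe n)).2 fun c _ => ?_)
  refine (Polynomial.degree_C_mul_X_pow_le _ _).trans_lt ?_
  exact Nat.cast_lt.2 (c.is_lt.trans_le hkn)

lemma monicOfLower_monic {n : ℕ} (hkn : k ≤ n) (z : Fin k → B) : (monicOfLower n z).Monic :=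
  Polynomial.monic_X_pow_sub (monicOfLower_degree_lt hkn z)

/-- The coefficient of `X ^ b` in the remainder of `X ^ m` modulo `X ^ n - ∑ z_c X ^ c`. -/
noncomputable def powModCoeff (n : ℕ) (z : Fin k → B) (m b : ℕ) : B :=
  (Polynomial.X ^ m %ₘ monicOfLower n z).coeff b

lemma powModCoeff_of_lt {n : ℕ} (hkn : k ≤ n) (z : Fin k → B) {m : ℕ} (hm : m < n) (b : ℕ) :
    powModCoeff n z m b = if b = m then 1 else 0 := by
  nontriviality B
  rw [powModCoeff, (Polynomial.modByMonic_eq_self_iff (monicOfLower_monic hkn z)).2,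
    Polynomial.coeff_X_pow]
  rw [Polynomial.degree_X_pow, monicOfLower,
    Polynomial.degree_sub_eq_left_of_degree_lt]
  · rw [Polynomial.degree_X_pow]
    exact_mod_cast hm
  · rw [Polynomial.degree_X_pow]
    exact monicOfLower_degree_lt hkn z

lemma powModCoeff_add {n : ℕ} (hkn : k ≤ n) (z : Fin k → B) (m b : ℕ) :
    powModCoeff n z (m + n) b = ∑ c : Fin k, z c * powModCoeff n z (m + c) b := by
  have h : (Polynomial.X ^ m * monicOfLower n z) %ₘ monicOfLower n z = 0 :=
    (Polynomial.modByMonic_eq_zero_iff_dvd (monicOfLower_monic hkn z)).2 (dvd_mul_left _ _)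
  have h2 : Polynomial.X ^ (m + n) = Polynomial.X ^ m * monicOfLower n z +
      ∑ c : Fin k, z c • (Polynomial.X ^ (m + (c : ℕ)) : Polynomial B) := by
    rw [monicOfLower, mul_sub, pow_add, Finset.mul_sum]
    simp only [Polynomial.smul_eq_C_mul, pow_add]
    refine eq_add_of_sub_eq (sub_right_inj.2 ?_)
    refine Finset.sum_congr rfl fun c _ => ?_
    ring
  rw [powModCoeff, h2, Polynomial.add_modByMonic, h, zero_add]
  have : ∀ q : Polynomial B, q %ₘ monicOfLower n z =
      Polynomial.modByMonicHom (monicOfLower n z) q := fun q => rfl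
  rw [this, map_sum, Polynomial.finsetSum_coeff]
  refine Finset.sum_congr rfl fun c _ => ?_
  rw [map_smul, Polynomial.coeff_smul, smul_eq_mul]
  rfl

/-- The ideal generated by `X_r ^ n - ∑ z_c X_r ^ c` for all `r`. -/
noncomputable def splitIdeal (n : ℕ) (z : Fin k → B) : Ideal (MvPolynomial (Fin k) B) :=
  Ideal.span (Set.range fun r => X r ^ n - ∑ c : Fin k, C (z c) * X r ^ (c : ℕ))

/-- The coefficient functional at the monomial `X ^ β` modulo `splitIdeal n z`. -/
noncomputable def splitCoeff (n : ℕ) (z : Fin k → B) (β : Fin k → ℕ) :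
    MvPolynomial (Fin k) B →ₗ[B] B :=
  (basisMonomials (Fin k) B).constr B fun m => ∏ i, powModCoeff n z (m i) (β i)

lemma splitCoeff_monomial (n : ℕ) (z : Fin k → B) (β : Fin k → ℕ) (m : Fin k →₀ ℕ) (r : B) :
    splitCoeff n z β (monomial m r) = r * ∏ i, powModCoeff n z (m i) (β i) := by
  have : monomial m r = r • basisMonomials (Fin k) B m := by
    rw [coe_basisMonomials, smul_monomial, smul_eq_mul, mul_one]
  rw [this, map_smul, splitCoeff, Module.Basis.constr_basis, smul_eq_mul]

/-- The functional is a product of one-variable remainder coefficients, one per variable, and a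
generator involves a single variable r; its factor at r vanishes by `powModCoeff_add`. -/
lemma splitCoeff_eq_zero {n : ℕ} (hkn : k ≤ n) (z : Fin k → B) (β : Fin k → ℕ)
    {f : MvPolynomial (Fin k) B} (hf : f ∈ splitIdeal n z) : splitCoeff n z β f = 0 := by
  obtain ⟨g, rfl⟩ := Ideal.mem_span_range_iff_exists_fun.1 hf
  rw [map_sum]
  refine Finset.sum_eq_zero fun r _ => ?_
  generalize g r = q
  induction q using MvPolynomial.induction_on' with
  | monomial m a =>
    have hC : ∀ (b : B) (e : ℕ), splitCoeff n z β (monomial m a * (C b * X r ^ e)) =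
        b * powModCoeff n z (m r + e) (β r) *
          (a * ∏ i ∈ Finset.univ.erase r, powModCoeff n z (m i) (β i)) := by
      intro b e
      rw [C_mul_X_pow_eq_monomial, monomial_mul, splitCoeff_monomial,
        ← Finset.mul_prod_erase _ _ (Finset.mem_univ r), Finsupp.add_apply,
        Finsupp.single_eq_same, Finset.prod_congr rfl fun i hi => by
          rw [Finsupp.add_apply, Finsupp.single_eq_of_ne (Finset.ne_of_mem_erase hi), add_zero]]
      ring
    rw [mul_sub, Finset.mul_sum, map_sub, map_sum]
    simp only [hC]
    rw [← one_mul (X r ^ n), ← C_1, hC, one_mul, ← Finset.sum_mul, powModCoeff_add hkn, sub_self]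
  | add p q hp hq => rw [add_mul, map_add, hp, hq, add_zero]

lemma splitCoeff_alternant (n : ℕ) (z : Fin k → B) (β l : Fin k → ℕ) :
    splitCoeff n z β (alternant X l) =
      (Matrix.of fun j i => powModCoeff n z (l j) (β i)).det := by
  have h := alternant_X_eq_sum (R := B) (Finsupp.equivFunOnFinite.symm l)
  rw [Finsupp.coe_equivFunOnFinite_symm] at h
  rw [h, map_sum, ← Matrix.det_transpose, Matrix.det_apply]
  refine Finset.sum_congr rfl fun σ _ => ?_
  rw [map_zsmul, Units.smul_def, rename_monomial, splitCoeff_monomial, one_mul,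
    ← Equiv.prod_comp σ]
  simp [Finsupp.mapDomain_apply σ.injective]

lemma splitCoeff_alternant_of_lt {n : ℕ} (hkn : k ≤ n) (z : Fin k → B) {β l : Fin k → ℕ}
    (hl : StrictMono l) (hβ : StrictMono β) (hln : ∀ i, l i < n) :
    splitCoeff n z β (alternant X l) = if β = l then 1 else 0 := by
  rw [splitCoeff_alternant]
  simp only [powModCoeff_of_lt hkn z (hln _)]
  split_ifs with h
  · subst h
    rw [← Matrix.det_one (n := Fin k) (R := B)]
    congr 1
    ext i j
    simp [Matrix.one_apply, hβ.injective.eq_iff, eq_comm]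
  -- Distinct strictly increasing vectors of the same length have distinct value sets, so some β_i
  -- is missed by l and gives a zero column.
  · obtain ⟨i, hi⟩ : ∃ i, ∀ j, β i ≠ l j := by
      by_contra! hcon
      apply h
      have hsub : Set.range β ⊆ Set.range l := by
        rintro _ ⟨i, rfl⟩
        obtain ⟨j, hj⟩ := hcon i
        exact ⟨j, hj.symm⟩
      have hfin : Set.range β = Set.range l := by
        refine Set.eq_of_subset_of_ncard_le hsub ?_ (Set.finite_range l)
        rw [← Set.image_univ, ← Set.image_univ, Set.ncard_image_of_injective _ hl.injective,
          Set.ncard_image_of_injective _ hβ.injective]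
      exact hβ.range_inj hl |>.1 hfin
    exact Matrix.det_eq_zero_of_column_eq_zero i fun j => by simp [hi j]

lemma eq_zero_of_sum_alternant_mem {n : ℕ} (hkn : k ≤ n) (z : Fin k → B) {ι : Type*}
    {l : ι → Fin k → ℕ} (hl : ∀ i, StrictMono (l i)) (hln : ∀ i j, l i j < n)
    (hinj : Function.Injective l) (g : ι →₀ B)
    (hg : (g.sum fun i b => C b * alternant X (l i)) ∈ splitIdeal n z) : g = 0 := by
  ext i
  have h := splitCoeff_eq_zero hkn z (l i) hg
  rw [Finsupp.sum, map_sum] at h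
  simp only [← smul_eq_C_mul, map_smul, splitCoeff_alternant_of_lt hkn z (hl _) (hl i) (hln _),
    smul_eq_mul, mul_ite, mul_one, mul_zero] at h
  rw [Finset.sum_eq_single i (fun j _ hj => if_neg fun h' => hj (hinj h').symm)
    (fun hi => by rw [if_pos rfl]; exact Finsupp.notMem_support_iff.1 hi), if_pos rfl] at h
  exact h

/-- Cramer's rule: multiply the row vector relation v V = 0 by the adjugate of the Vandermonde
matrix V. No regularity of the determinant is needed, which matters because this is applied in a
quotient ring. -/
lemma mul_alternant_eq_zero {x v : Fin k → B} (hv : ∀ r, ∑ c, v c * x r ^ (c : ℕ) = 0)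
    (c : Fin k) : v c * alternant x (fun j => (j : ℕ)) = 0 := by
  let V : Matrix (Fin k) (Fin k) B := Matrix.of fun j i => x i ^ (j : ℕ)
  have hvV : Matrix.vecMul v V = 0 := funext hv
  have h := congrArg (fun w => Matrix.vecMul w V.adjugate) hvV
  simp only [Matrix.vecMul_vecMul, Matrix.mul_adjugate, Matrix.vecMul_smul, Matrix.vecMul_one,
    Matrix.zero_vecMul] at h
  rw [mul_comm]
  exact congrFun h c

variable {R : Type*} [CommRing R]

/-- Modulo `splitIdeal`, the coefficients of the universal relation become constants. -/
lemma mul_alternant_sub_mem {n : ℕ} {y : Fin k → MvPolynomial (Fin k) R}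
    (hy : ∀ r, (X r : MvPolynomial (Fin k) R) ^ n = ∑ c : Fin k, y c.rev * X r ^ (c : ℕ))
    (g : MvPolynomial (Fin k) R) :
    (map (C : R →+* MvPolynomial (Fin k) R) (aeval y g) - C g) *
      alternant X (fun j => (j : ℕ)) ∈
        splitIdeal n (fun c : Fin k => (X c.rev : MvPolynomial (Fin k) R)) := by
  set J := splitIdeal n (fun c : Fin k => (X c.rev : MvPolynomial (Fin k) R)) with hJ
  set δ : MvPolynomial (Fin k) (MvPolynomial (Fin k) R) := alternant X (fun j => (j : ℕ))
  induction g using MvPolynomial.induction_on with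
  | C a => simp
  | add p q hp hq =>
    have := add_mem hp hq
    convert this using 1
    simp only [map_add]
    ring
  | mul_X p i hp =>
    -- In the quotient, X_r ^ n has one expansion with coefficients y and one with the constants;
    -- their difference is a Vandermonde relation.
    have hX : (map (C : R →+* MvPolynomial (Fin k) R) (y i) - C (X i)) * δ ∈ J := by
      let Q := MvPolynomial (Fin k) (MvPolynomial (Fin k) R) ⧸ J
      let v : Fin k → Q := fun c => Ideal.Quotient.mk J
        (map (C : R →+* MvPolynomial (Fin k) R) (y c.rev) - C (X c.rev))
      have hv : ∀ r, ∑ c, v c * Ideal.Quotient.mk J (X r) ^ (c : ℕ) = 0 := by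
        intro r
        have h1 : Ideal.Quotient.mk J (X r ^ n - ∑ c : Fin k, C (X c.rev) * X r ^ (c : ℕ)) = 0 :=
          Ideal.Quotient.eq_zero_iff_mem.2 (Ideal.subset_span ⟨r, rfl⟩)
        have h2 := congrArg (map (C : R →+* MvPolynomial (Fin k) R)) (hy r)
        rw [map_pow, map_X, map_sum] at h2
        simp only [map_mul, map_pow, map_X] at h2
        rw [h2, ← Finset.sum_sub_distrib, map_sum] at h1
        rw [← h1]
        refine Finset.sum_congr rfl fun c _ => ?_
        rw [← sub_mul, map_mul, map_pow]
      have hi := mul_alternant_eq_zero hv i.rev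
      rw [← map_alternant, ← map_mul, Ideal.Quotient.eq_zero_iff_mem, Fin.rev_rev] at hi
      exact hi
    have := add_mem (J.mul_mem_left (C (X i)) hp)
      (J.mul_mem_left (map (C : R →+* MvPolynomial (Fin k) R) (aeval y p)) hX)
    convert this using 1
    simp only [map_mul, aeval_X]
    ring

/-- Independence of the Schur-type family over the polynomial ring generated by the `y_c`. -/
lemma eq_zero_of_sum_aeval_mul {n : ℕ} (hkn : k ≤ n) {y : Fin k → MvPolynomial (Fin k) R}
    (hy : ∀ r, (X r : MvPolynomial (Fin k) R) ^ n = ∑ c : Fin k, y c.rev * X r ^ (c : ℕ))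
    {ι : Type*} {l : ι → Fin k → ℕ} (hl : ∀ i, StrictMono (l i)) (hln : ∀ i j, l i j < n)
    (hinj : Function.Injective l) {s : ι → MvPolynomial (Fin k) R}
    (hs : ∀ i, s i * alternant X (fun j => (j : ℕ)) = alternant X (l i))
    (g : ι →₀ MvPolynomial (Fin k) R)
    (hg : (g.sum fun i b => aeval y b * s i) = 0) : g = 0 := by
  refine eq_zero_of_sum_alternant_mem hkn (fun c : Fin k => (X c.rev : MvPolynomial (Fin k) R))
    hl hln hinj g ?_
  have h := congrArg (fun p => map (C : R →+* MvPolynomial (Fin k) R) p *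
    alternant X (fun j => (j : ℕ))) hg
  simp only [Finsupp.sum, map_sum, map_mul, map_zero, zero_mul, Finset.sum_mul] at h
  rw [Finsupp.sum, ← sub_zero (Finset.sum _ _), ← h, ← Finset.sum_sub_distrib]
  refine sum_mem fun i _ => ?_
  have hsi := congrArg (map (C : R →+* MvPolynomial (Fin k) R)) (hs i)
  rw [map_mul, map_alternant, map_alternant] at hsi
  simp only [map_X] at hsi
  have := (splitIdeal n (fun c : Fin k => (X c.rev : MvPolynomial (Fin k) R))).mul_mem_left
    (-map (C : R →+* MvPolynomial (Fin k) R) (s i)) (mul_alternant_sub_mem hy (g i))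
  convert this using 1
  rw [← hsi]
  ring

end Independence

/-! ### Leading homogeneous parts -/

section LowerDegree

variable {R σ : Type*} [CommRing R]

/-- The polynomials all of whose monomials have degree less than `d`. -/
noncomputable def lowerDegree (σ R : Type*) [CommRing R] (d : ℕ) :
    Submodule R (MvPolynomial σ R) :=
  restrictSupport R {m | m.degree < d}

lemma mem_lowerDegree {d : ℕ} {f : MvPolynomial σ R} :
    f ∈ lowerDegree σ R d ↔ ∀ m ∈ f.support, m.degree < d := Iff.rfl

lemma lowerDegree_mono {d e : ℕ} (h : d ≤ e) : lowerDegree σ R d ≤ lowerDegree σ R e :=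
  restrictSupport_mono R fun _ hm => lt_of_lt_of_le hm h

lemma mem_lowerDegree_of_totalDegree_lt {d : ℕ} {f : MvPolynomial σ R}
    (hf : f.totalDegree < d) : f ∈ lowerDegree σ R d := fun m hm => by
  have h : m.degree ≤ f.totalDegree := by
    rw [Finsupp.degree_apply]
    exact le_totalDegree hm
  exact h.trans_lt hf

lemma MvPolynomial.IsHomogeneous.mem_lowerDegree {d : ℕ} {f : MvPolynomial σ R}
    (hf : f.IsHomogeneous d) : f ∈ lowerDegree σ R (d + 1) := fun m hm => by
  by_contra h
  refine mem_support_iff.1 hm (hf.coeff_eq_zero fun h' => h ?_)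
  rw [Set.mem_ofPred_eq]
  omega

lemma mul_mem_lowerDegree {d e : ℕ} {f g : MvPolynomial σ R} (hf : f ∈ lowerDegree σ R d)
    (hg : g ∈ lowerDegree σ R (e + 1)) : f * g ∈ lowerDegree σ R (d + e) := by
  classical
  intro m hm
  obtain ⟨a, ha, b, hb, rfl⟩ := Finset.mem_add.1 (support_mul f g hm)
  have h1 : a.degree < d := hf ha
  have h2 : b.degree < e + 1 := hg hb
  rw [Set.mem_ofPred_eq, map_add]
  omega

lemma homogeneousComponent_eq_zero_of_mem_lowerDegree {d e : ℕ} {f : MvPolynomial σ R}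
    (hf : f ∈ lowerDegree σ R d) (h : d ≤ e) : homogeneousComponent e f = 0 := by
  ext m
  rw [coeff_homogeneousComponent, coeff_zero]
  split_ifs with hm
  · by_contra hc
    have : m.degree < d := hf (mem_support_iff.2 hc)
    omega
  · rfl

/-- `g` is homogeneous of degree `d`, and `f` agrees with it up to terms of lower degree. -/
structure HasTop (d : ℕ) (f g : MvPolynomial σ R) : Prop where
  homogeneous : g.IsHomogeneous d
  sub_mem : f - g ∈ lowerDegree σ R d

namespace HasTop

lemma refl {d : ℕ} {f : MvPolynomial σ R} (hf : f.IsHomogeneous d) : HasTop d f f :=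
  ⟨hf, by rw [sub_self]; exact zero_mem _⟩

lemma mem_lowerDegree {d : ℕ} {f g : MvPolynomial σ R} (h : HasTop d f g) :
    f ∈ lowerDegree σ R (d + 1) := by
  rw [← sub_add_cancel f g]
  exact add_mem (lowerDegree_mono (Nat.le_succ d) h.sub_mem) h.homogeneous.mem_lowerDegree

lemma mul {d e : ℕ} {f g f' g' : MvPolynomial σ R} (h : HasTop d f g) (h' : HasTop e f' g') :
    HasTop (d + e) (f * f') (g * g') := by
  refine ⟨h.homogeneous.mul h'.homogeneous, ?_⟩
  have e1 : f * f' - g * g' = (f - g) * f' + (f' - g') * g := by ring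
  rw [e1]
  refine add_mem (mul_mem_lowerDegree h.sub_mem h'.mem_lowerDegree) ?_
  rw [add_comm d e]
  exact mul_mem_lowerDegree h'.sub_mem h.homogeneous.mem_lowerDegree

lemma pow {d : ℕ} {f g : MvPolynomial σ R} (h : HasTop d f g) (m : ℕ) :
    HasTop (m * d) (f ^ m) (g ^ m) := by
  induction m with
  | zero => simpa using refl (isHomogeneous_one σ R)
  | succ m ih =>
    rw [pow_succ, pow_succ, Nat.succ_mul]
    exact ih.mul h

lemma prod {ι : Type*} (s : Finset ι) {d : ι → ℕ} {f g : ι → MvPolynomial σ R}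
    (h : ∀ i ∈ s, HasTop (d i) (f i) (g i)) :
    HasTop (∑ i ∈ s, d i) (∏ i ∈ s, f i) (∏ i ∈ s, g i) := by
  classical
  induction s using Finset.induction_on with
  | empty => simpa using refl (isHomogeneous_one σ R)
  | insert a s ha ih =>
    rw [Finset.sum_insert ha, Finset.prod_insert ha, Finset.prod_insert ha]
    exact (h a (Finset.mem_insert_self a s)).mul
      (ih fun i hi => h i (Finset.mem_insert_of_mem hi))

lemma homogeneousComponent {d e : ℕ} {f g : MvPolynomial σ R} (h : HasTop d f g) (hde : d ≤ e) :
    MvPolynomial.homogeneousComponent e f = if d = e then g else 0 := by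
  rw [← sub_add_cancel f g, map_add,
    homogeneousComponent_eq_zero_of_mem_lowerDegree h.sub_mem hde, zero_add,
    homogeneousComponent_of_mem h.homogeneous]
  simp only [eq_comm]

end HasTop

/-- A linear map whose leading part is injective is injective. -/
lemma injective_of_hasTop {κ M : Type*} [AddCommGroup M] [Module R M] (β : Module.Basis κ R M)
    (d : κ → ℕ) {φ ψ : M →ₗ[R] MvPolynomial σ R} (h : ∀ i, HasTop (d i) (φ (β i)) (ψ (β i)))
    (hψ : Function.Injective ψ) : Function.Injective φ := by
  rw [injective_iff_map_eq_zero]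
  intro x hx
  by_contra hne
  have hsupp : (β.repr x).support.Nonempty :=
    Finsupp.support_nonempty_iff.2 ((map_ne_zero_iff _ β.repr.injective).2 hne)
  obtain ⟨i₀, hi₀, hmax⟩ := Finset.exists_max_image _ d hsupp
  have hsum : x = ∑ i ∈ (β.repr x).support, β.repr x i • β i := by
    conv_lhs => rw [← β.linearCombination_repr x, Finsupp.linearCombination_apply, Finsupp.sum]
  -- The part of x of maximal weight. The degree d i₀ component of φ x = 0 is exactly ψ x'.
  let x' : M := ∑ i ∈ (β.repr x).support, (if d i = d i₀ then β.repr x i else 0) • β i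
  have hx' : ψ x' = 0 := by
    rw [← map_zero (homogeneousComponent (R := R) (σ := σ) (d i₀)), ← hx]
    conv_rhs => rw [hsum]
    rw [map_sum, map_sum, map_sum]
    refine Finset.sum_congr rfl fun i hi => ?_
    rw [map_smul, map_smul, map_smul, (h i).homogeneousComponent (hmax i hi)]
    split_ifs <;> simp
  have hx'0 : x' = 0 := (map_eq_zero_iff ψ hψ).1 hx'
  have h1 := congrArg (fun v => β.repr v i₀) hx'0
  simp only [x', map_sum, map_smul, Module.Basis.repr_self, Finsupp.coe_finsetSum,
    Finset.sum_apply, Finsupp.smul_single, smul_eq_mul, mul_one, map_zero,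
    Finsupp.coe_zero, Pi.zero_apply] at h1
  rw [Finset.sum_eq_single i₀ (fun j _ hj => Finsupp.single_eq_of_ne hj.symm)
    (fun hn => absurd hi₀ hn), Finsupp.single_eq_same, if_pos rfl] at h1
  exact Finsupp.mem_support_iff.1 hi₀ h1

end LowerDegree

/-! ### From freeness over a polynomial ring to freeness of the quotient -/

section PolynomialCombination

variable {R A ι τ : Type*} [CommRing R] [CommRing A] [Algebra R A]

/-- The `R`-linear map sending `(g_i)` to `∑ g_i(y) s_i`. -/
noncomputable def polynomialCombination (y : τ → A) (s : ι → A) :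
    (ι →₀ MvPolynomial τ R) →ₗ[R] A :=
  Finsupp.lsum R fun i => (LinearMap.mulRight R (s i)).comp (aeval y).toLinearMap

lemma polynomialCombination_apply (y : τ → A) (s : ι → A) (g : ι →₀ MvPolynomial τ R) :
    polynomialCombination y s g = g.sum fun i b => aeval y b * s i := rfl

lemma polynomialCombination_single (y : τ → A) (s : ι → A) (i : ι) (b : MvPolynomial τ R) :
    polynomialCombination y s (Finsupp.single i b) = aeval y b * s i := by
  rw [polynomialCombination_apply, Finsupp.sum_single_index (by rw [map_zero, zero_mul])]

lemma polynomialCombination_smul (y : τ → A) (s : ι → A) (p : MvPolynomial τ R)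
    (g : ι →₀ MvPolynomial τ R) :
    polynomialCombination y s (p • g) = aeval y p * polynomialCombination y s g := by
  induction g using Finsupp.induction_linear with
  | zero => simp
  | add g h hg hh => rw [smul_add, map_add, hg, hh, map_add, mul_add]
  | single i b =>
    rw [Finsupp.smul_single, polynomialCombination_single, polynomialCombination_single,
      smul_eq_mul, map_mul, mul_assoc]

lemma map_polynomialCombination {B : Type*} [CommRing B] [Algebra R B] (f : A →ₐ[R] B)
    (y : τ → A) (s : ι → A) (g : ι →₀ MvPolynomial τ R) :
    f (polynomialCombination y s g) =
      polynomialCombination (fun c => f (y c)) (fun i => f (s i)) g := by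
  rw [polynomialCombination_apply, polynomialCombination_apply, Finsupp.sum, Finsupp.sum, map_sum]
  refine Finset.sum_congr rfl fun i _ => ?_
  rw [map_mul]
  congr 1
  exact comp_aeval_apply _ f (g i)

/-- If `A` is free over `R[y]` with basis `s`, then `A / (y)` is free over `R` with basis `s`. -/
lemma exists_basis_quotient_of_bijective {y : τ → A} {s : ι → A} [Fintype τ]
    (h : Function.Bijective (polynomialCombination (R := R) y s)) {I : Ideal A}
    (hI : I = Ideal.span (Set.range y)) :
    ∃ b : Module.Basis ι R (A ⧸ I), ∀ i, b i = Ideal.Quotient.mk I (s i) := by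
  have hli : LinearIndependent R fun i => Ideal.Quotient.mk I (s i) := by
    rw [linearIndependent_iff]
    intro c hc
    have h1 : polynomialCombination (R := R) y s (c.mapRange C (map_zero _)) ∈ I := by
      rw [← Ideal.Quotient.eq_zero_iff_mem, ← hc, polynomialCombination_apply,
        Finsupp.sum_mapRange_index (fun i => by rw [map_zero, zero_mul]), Finsupp.sum, map_sum,
        Finsupp.linearCombination_apply, Finsupp.sum]
      refine Finset.sum_congr rfl fun i _ => ?_
      rw [aeval_C, ← Algebra.smul_def]
      rfl
    rw [hI, Ideal.mem_span_range_iff_exists_fun] at h1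
    obtain ⟨q, hq⟩ := h1
    choose g hg using fun i => h.2 (q i)
    -- Uniqueness of expansions puts the constants c in the ideal generated by the variables, so
    -- taking constant terms gives c = 0.
    have h2 : c.mapRange C (map_zero _) = ∑ t, (X t : MvPolynomial τ R) • g t := by
      apply h.1
      rw [← hq, map_sum]
      refine Finset.sum_congr rfl fun t _ => ?_
      rw [polynomialCombination_smul, aeval_X, hg, mul_comm]
    ext i
    have h3 := congrArg (fun v => constantCoeff (v i)) h2
    simpa [Finsupp.finsetSum_apply] using h3
  have hspan : ⊤ ≤ Submodule.span R (Set.range fun i => Ideal.Quotient.mk I (s i)) := by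
    rintro x -
    obtain ⟨a, rfl⟩ := Ideal.Quotient.mk_surjective x
    obtain ⟨g, rfl⟩ := h.2 a
    rw [polynomialCombination_apply, Finsupp.sum, map_sum]
    refine sum_mem fun i _ => ?_
    have h1 : Ideal.Quotient.mk I (aeval y (g i) * s i) =
        constantCoeff (g i) • Ideal.Quotient.mk I (s i) := by
      have h2 : Ideal.Quotient.mkₐ R I (aeval y (g i)) =
          algebraMap R (A ⧸ I) (constantCoeff (g i)) := by
        rw [comp_aeval_apply]
        have : (fun t => Ideal.Quotient.mkₐ R I (y t)) = fun _ => 0 := by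
          funext t
          refine Ideal.Quotient.eq_zero_iff_mem.2 ?_
          rw [hI]
          exact Ideal.subset_span ⟨t, rfl⟩
        rw [this, aeval_zero']
      rw [map_mul, Algebra.smul_def, ← h2]
      rfl
    rw [h1]
    exact Submodule.smul_mem _ _ (Submodule.subset_span ⟨i, rfl⟩)
  exact ⟨Module.Basis.mk hli hspan, fun i => Module.Basis.mk_apply hli hspan i⟩

end PolynomialCombination

/-! ### Straightening, injectivity and the deformed generators -/

section Main

variable {R : Type*} [CommRing R] {k : ℕ}

lemma rowLen_eq_zero_of_length_le {μ : YoungDiagram} (h : μ.rowLens.length ≤ k) :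
    μ.rowLen k = 0 := by
  rw [YoungDiagram.length_rowLens] at h
  by_contra hne
  have := YoungDiagram.mem_iff_lt_colLen.1
    (YoungDiagram.mem_iff_lt_rowLen.2 (Nat.pos_of_ne_zero hne))
  omega

lemma mem_partitionsInRectangle_iff {n : ℕ} {μ : YoungDiagram} :
    μ ∈ partitionsInRectangle k n ↔ μ.rowLen k = 0 ∧ ∀ i, μ.rowLen i ≤ n - k := by
  constructor
  · rintro ⟨h1, h2⟩
    refine ⟨rowLen_eq_zero_of_length_le h1, fun i => ?_⟩
    by_cases hi : i < μ.rowLens.length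
    · rw [← YoungDiagram.get_rowLens (h := hi)]
      exact h2 _ (List.getElem_mem hi)
    · rw [rowLen_eq_zero_of_le (rowLen_eq_zero_of_length_le le_rfl) (not_lt.1 hi)]
      exact Nat.zero_le _
  · rintro ⟨h1, h2⟩
    constructor
    · rw [YoungDiagram.length_rowLens]
      by_contra! hlt
      have := YoungDiagram.mem_iff_lt_rowLen.1 (YoungDiagram.mem_iff_lt_colLen.2 hlt)
      omega
    · intro p hp
      obtain ⟨i, hi, rfl⟩ := List.getElem_of_mem hp
      rw [YoungDiagram.get_rowLens]
      exact h2 i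

lemma shiftedRows_lt {n : ℕ} (hkn : k ≤ n) {μ : YoungDiagram}
    (hμ : μ ∈ partitionsInRectangle k n) (j : Fin k) : shiftedRows k μ j < n := by
  have := (mem_partitionsInRectangle_iff.1 hμ).2 (k - 1 - j)
  simp only [shiftedRows]
  omega

lemma mem_partitionsInRectangle_of_shiftedRows_lt {n : ℕ} {μ : YoungDiagram}
    (hμ : μ.rowLen k = 0) (h : ∀ j, shiftedRows k μ j < n) : μ ∈ partitionsInRectangle k n := by
  refine mem_partitionsInRectangle_iff.2 ⟨hμ, fun i => ?_⟩
  refine (μ.rowLen_anti 0 i (Nat.zero_le i)).trans ?_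
  rcases Nat.eq_zero_or_pos k with rfl | hk
  · omega
  · have h1 := h ⟨k - 1 - 0, by omega⟩
    rw [shiftedRows_rev μ hk] at h1
    omega

lemma exists_perm_strictMono {f : Fin k → ℕ} (hf : Function.Injective f) :
    ∃ σ : Equiv.Perm (Fin k), StrictMono (f ∘ σ) :=
  ⟨Tuple.sort f, (Tuple.monotone_sort f).strictMono_of_injective
    (hf.comp (Tuple.sort f).injective)⟩

/-- The Schur polynomials of the partitions in the rectangle. -/
noncomputable def rectangleSchur (R : Type*) [CommRing R] (k n : ℕ) (μ : partitionsInRectangle k n) :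
    MvPolynomial (Fin k) R := schurSum X μ.1

lemma rectangleSchur_mul_staircase {n : ℕ} (μ : partitionsInRectangle k n) :
    rectangleSchur R k n μ * alternant X (fun j => (j : ℕ)) = alternant X (shiftedRows k μ) :=
  schurSum_mul_staircase _ (mem_partitionsInRectangle_iff.1 μ.2).1

/-- Straightening: each alternant is the staircase alternant times a combination of the Schur
polynomials in the rectangle with coefficients polynomial in the `w_c`. -/
lemma exists_alternant_eq {n : ℕ} (hkn : k ≤ n) {y w : Fin k → MvPolynomial (Fin k) R}
    (hy : ∀ r, (X r : MvPolynomial (Fin k) R) ^ n = ∑ c : Fin k, y c.rev * X r ^ (c : ℕ))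
    (hsymm : ∀ c, (y c - w c).IsSymmetric)
    (hlow : ∀ c : Fin k, y c - w c ∈ lowerDegree (Fin k) R (n - k + (c + 1)))
    (f : Fin k →₀ ℕ) :
    alternant X f ∈ (LinearMap.range
      (polynomialCombination (R := R) w (rectangleSchur R k n))).map
        (LinearMap.mulRight R (alternant X (fun j => (j : ℕ)))) := by
  set N := (LinearMap.range
    (polynomialCombination (R := R) w (rectangleSchur R k n))).map
      (LinearMap.mulRight R (alternant X (fun j => (j : ℕ)))) with hN
  have hmul : ∀ (c : Fin k) (p : MvPolynomial (Fin k) R), p ∈ N → w c * p ∈ N := by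
    rintro c _ ⟨_, ⟨g, rfl⟩, rfl⟩
    refine ⟨_, ⟨(X c : MvPolynomial (Fin k) R) • g, rfl⟩, ?_⟩
    rw [polynomialCombination_smul, aeval_X, LinearMap.mulRight_apply, LinearMap.mulRight_apply,
      mul_assoc]
  generalize hd : f.degree = d
  induction d using Nat.strong_induction_on generalizing f with
  | _ d ih =>
  by_cases hinj : Function.Injective f
  swap
  · rw [alternant_eq_zero_of_not_injective _ hinj]
    exact zero_mem N
  by_cases hlt : ∀ i, f i < n
  · obtain ⟨σ, hσ⟩ := exists_perm_strictMono hinj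
    obtain ⟨μ, hμ, hμf⟩ := exists_shiftedRows_eq hσ
    have hmem : μ ∈ partitionsInRectangle k n :=
      mem_partitionsInRectangle_of_shiftedRows_lt hμ fun j => by rw [hμf]; exact hlt (σ j)
    have h1 : alternant (X : Fin k → MvPolynomial (Fin k) R) (f ∘ σ) ∈ N := by
      refine ⟨_, ⟨Finsupp.single ⟨μ, hmem⟩ 1, rfl⟩, ?_⟩
      rw [polynomialCombination_single, map_one, one_mul, LinearMap.mulRight_apply,
        rectangleSchur_mul_staircase, hμf]
    have h2 : alternant (X : Fin k → MvPolynomial (Fin k) R) f =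
        (Equiv.Perm.sign σ⁻¹ : ℤ) • alternant X (f ∘ σ) := by
      rw [zsmul_eq_mul, ← alternant_comp_perm]
      congr 1
      ext j
      simp
    rw [h2]
    exact zsmul_mem h1 _
  · push Not at hlt
    obtain ⟨i, hi⟩ := hlt
    obtain ⟨e, he⟩ := Nat.exists_eq_add_of_le' hi
    have hf : ⇑f = Function.update (⇑f) i (e + n) := by rw [← he, Function.update_eq_self]
    rw [hf, alternant_update_reduce hy]
    refine sum_mem fun c _ => ?_
    have hupd : Function.update (⇑f) i (e + (c : ℕ)) = ⇑(f.update i (e + (c : ℕ))) :=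
      (Finsupp.coe_update _ _ _).symm
    rw [hupd]
    -- Lowering i from e + n to e + c saves n - c in total degree.
    have hdeg : (f.update i (e + (c : ℕ))).degree + (n - c) = d := by
      rw [← hd, Finsupp.degree_eq_sum, Finsupp.degree_eq_sum, Finsupp.coe_update,
        Finset.sum_update_of_mem (Finset.mem_univ i),
        ← Finset.add_sum_erase _ _ (Finset.mem_univ i), Finset.sdiff_singleton_eq_erase, he]
      have := c.is_lt
      omega
    have hc := c.is_lt
    rw [← sub_add_cancel (y c.rev) (w c.rev), add_mul]
    -- The w part is covered by induction as c < n. In the error part every monomial has degree < n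
    -- - k + (rev c + 1) = n - c, strictly less than what was saved.
    refine add_mem ?_ (hmul _ _ (ih _ (by omega) _ rfl))
    rw [(hsymm _).mul_alternant]
    refine sum_mem fun m hm => N.smul_mem _ (ih _ ?_ _ rfl)
    have := mem_lowerDegree.1 (hlow c.rev) m hm
    rw [Fin.val_rev] at this
    rw [map_add]
    omega

/-- Each w^m s_λ has leading part y^m s_λ, so the claim reduces to independence for y, proved by
`eq_zero_of_sum_aeval_mul`. -/
lemma polynomialCombination_injective {n : ℕ} (hkn : k ≤ n)
    {y w : Fin k → MvPolynomial (Fin k) R}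
    (hy : ∀ r, (X r : MvPolynomial (Fin k) R) ^ n = ∑ c : Fin k, y c.rev * X r ^ (c : ℕ))
    {d : Fin k → ℕ} (hw : ∀ c, HasTop (d c) (w c) (y c)) :
    Function.Injective (polynomialCombination (R := R) w (rectangleSchur R k n)) := by
  refine injective_of_hasTop (Finsupp.basis fun _ => basisMonomials (Fin k) R)
    (fun p => ∑ c, p.2 c * d c + p.1.1.cells.card)
    (ψ := polynomialCombination (R := R) y (rectangleSchur R k n)) (fun p => ?_) ?_
  · simp only [Finsupp.coe_basis, coe_basisMonomials, polynomialCombination_single,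
      aeval_monomial, map_one, one_mul]
    rw [Finsupp.prod_fintype _ _ fun _ => pow_zero _, Finsupp.prod_fintype _ _ fun _ => pow_zero _]
    exact (HasTop.prod _ fun c _ => (hw c).pow _).mul (HasTop.refl (isHomogeneous_schurSum _))
  · rw [injective_iff_map_eq_zero]
    intro g hg
    refine eq_zero_of_sum_aeval_mul hkn hy (l := fun μ : partitionsInRectangle k n =>
      shiftedRows k μ) (fun μ => shiftedRows_strictMono k μ) (fun μ => shiftedRows_lt hkn μ.2)
      (fun μ ν h => Subtype.ext (shiftedRows_injective (mem_partitionsInRectangle_iff.1 μ.2).1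
        (mem_partitionsInRectangle_iff.1 ν.2).1 h)) rectangleSchur_mul_staircase g hg

lemma exists_polynomialCombination_eq {n : ℕ} (hkn : k ≤ n)
    {y w : Fin k → MvPolynomial (Fin k) R}
    (hy : ∀ r, (X r : MvPolynomial (Fin k) R) ^ n = ∑ c : Fin k, y c.rev * X r ^ (c : ℕ))
    (hsymm : ∀ c, (y c - w c).IsSymmetric)
    (hlow : ∀ c : Fin k, y c - w c ∈ lowerDegree (Fin k) R (n - k + (c + 1)))
    {f : MvPolynomial (Fin k) R} (hf : f.IsSymmetric) :
    ∃ g, polynomialCombination (R := R) w (rectangleSchur R k n) g = f := by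
  have hmem : f * alternant X (fun j => (j : ℕ)) ∈ (LinearMap.range
      (polynomialCombination (R := R) w (rectangleSchur R k n))).map
        (LinearMap.mulRight R (alternant X (fun j => (j : ℕ)))) := by
    have := hf.mul_alternant (Finsupp.equivFunOnFinite.symm fun j => (j : ℕ))
    rw [Finsupp.coe_equivFunOnFinite_symm] at this
    rw [this]
    exact sum_mem fun m _ => Submodule.smul_mem _ _ (exists_alternant_eq hkn hy hsymm hlow _)
  obtain ⟨_, ⟨g, rfl⟩, hg⟩ := hmem
  exact ⟨g, isRegular_staircase.right hg⟩

/-- Any coefficients obtained by division satisfy the triangular system, whose solution is unique.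
This makes them explicit polynomials in the h_m, hence symmetric and homogeneous. -/
lemma pow_eq_sum_triangularSolve {n : ℕ} (hkn : k ≤ n) (r : Fin k) :
    (X r : MvPolynomial (Fin k) R) ^ n = ∑ c : Fin k,
      triangularSolve (hsymm (Fin k) R) (fun i : Fin k => hsymm (Fin k) R (n - k + (i + 1))) c.rev *
        X r ^ (c : ℕ) := by
  obtain ⟨z, hz⟩ := exists_pow_eq_sum (X : Fin k → MvPolynomial (Fin k) R) n
  have hy : ∀ r, (X r : MvPolynomial (Fin k) R) ^ n =
      ∑ c : Fin k, (z ∘ Fin.rev) c.rev * X r ^ (c : ℕ) := by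
    simpa using hz
  have := eq_triangularSolve (c := hsymm (Fin k) R) (w := z ∘ Fin.rev)
    (g := fun i : Fin k => hsymm (Fin k) R (n - k + (i + 1))) fun i => by
      simp only [hsymm_eq_hsum]
      rw [hsum_eq_sum_of_pow_eq hkn hy, ← Finset.Iio_insert, Finset.sum_insert (by simp)]
      rw [Nat.sub_self, hsum_zero, one_mul, add_comm]
  rw [← this]
  exact hy r

/-- The system is homogeneous, with its i-th equation in degree n - k + (i + 1); perturbing the
right sides by lower-degree terms changes only lower-degree terms of the solution. -/
lemma hasTop_triangularSolve {n : ℕ} {b : Fin k → MvPolynomial (Fin k) R}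
    (hb : ∀ i : Fin k, b i ∈ lowerDegree (Fin k) R (n - k + (i + 1))) (i : Fin k) :
    HasTop (n - k + (i + 1))
      (triangularSolve (hsymm (Fin k) R)
        (fun i : Fin k => hsymm (Fin k) R (n - k + (i + 1)) - b i) i)
      (triangularSolve (hsymm (Fin k) R)
        (fun i : Fin k => hsymm (Fin k) R (n - k + (i + 1))) i) := by
  induction i using WellFoundedLT.induction with
  | ind i ih =>
    have hterm : ∀ j ∈ Finset.Iio i, HasTop (n - k + (i + 1)) _ _ := fun j hj => by
      have h := (HasTop.refl (isHomogeneous_hsymm (R := R) (Fin k) (i - j))).mul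
        (ih j (Finset.mem_Iio.1 hj))
      have e : (i : ℕ) - j + (n - k + (j + 1)) = n - k + (i + 1) := by
        have := Fin.lt_def.1 (Finset.mem_Iio.1 hj)
        omega
      rwa [e] at h
    rw [triangularSolve_eq, triangularSolve_eq]
    refine ⟨(isHomogeneous_hsymm _ _).sub (IsHomogeneous.sum _ _ _ fun j hj =>
      (hterm j hj).homogeneous), ?_⟩
    rw [sub_sub_sub_comm, sub_sub_cancel_left, ← Finset.sum_sub_distrib]
    exact sub_mem (neg_mem (hb i)) (sum_mem fun j hj => (hterm j hj).sub_mem)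

end Main

theorem mainTheorem1 {R : Type*} [CommRing R] (k n : ℕ) (hkn : k ≤ n)
    (a : Fin k → symmetricSubalgebra (Fin k) R)
    (ha : ∀ i : Fin k,
      (a i : MvPolynomial (Fin k) R).totalDegree < n - k + ((i : ℕ) + 1)) :
    Module.Free R (symmetricSubalgebra (Fin k) R ⧸ grassmannianIdeal k n a) ∧
    ∃ b : Module.Basis (partitionsInRectangle k n) R
        (symmetricSubalgebra (Fin k) R ⧸ grassmannianIdeal k n a),
      ∀ μ : partitionsInRectangle k n,
        ∃ hμ : schurPolynomial k R μ ∈ symmetricSubalgebra (Fin k) R,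
          b μ = Ideal.Quotient.mk (grassmannianIdeal k n a) ⟨schurPolynomial k R μ, hμ⟩ := by
  have hs : ∀ μ : partitionsInRectangle k n,
      schurPolynomial k R μ ∈ symmetricSubalgebra (Fin k) R := fun μ => by
    rw [schurPolynomial_eq_schurSum]
    exact isSymmetric_schurSum (mem_partitionsInRectangle_iff.1 μ.2).1
  let s : partitionsInRectangle k n → symmetricSubalgebra (Fin k) R := fun μ => ⟨_, hs μ⟩
  let w : Fin k → symmetricSubalgebra (Fin k) R := triangularSolve (completeHomogeneous k R)
    fun i : Fin k => completeHomogeneous k R (n - k + ((i : ℕ) + 1)) - a i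
  let w' : Fin k → MvPolynomial (Fin k) R := triangularSolve (hsymm (Fin k) R)
    fun i : Fin k => hsymm (Fin k) R (n - k + ((i : ℕ) + 1)) - a i
  let y : Fin k → symmetricSubalgebra (Fin k) R := triangularSolve (completeHomogeneous k R)
    fun i : Fin k => completeHomogeneous k R (n - k + ((i : ℕ) + 1))
  let y' : Fin k → MvPolynomial (Fin k) R := triangularSolve (hsymm (Fin k) R)
    fun i : Fin k => hsymm (Fin k) R (n - k + ((i : ℕ) + 1))
  have hw : ∀ c, (w c : MvPolynomial (Fin k) R) = w' c := fun c =>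
    map_triangularSolve (symmetricSubalgebra (Fin k) R).val _ _ c
  have hy : ∀ c, (y c : MvPolynomial (Fin k) R) = y' c := fun c =>
    map_triangularSolve (symmetricSubalgebra (Fin k) R).val _ _ c
  have htop : ∀ c : Fin k, HasTop (n - k + (c + 1)) (w' c) (y' c) :=
    hasTop_triangularSolve fun i => mem_lowerDegree_of_totalDegree_lt (ha i)
  have hpow := pow_eq_sum_triangularSolve (R := R) hkn
  -- Freeness is proved in the full polynomial ring, where δ lives, and transported back to the
  -- symmetric subalgebra.
  have hval : ∀ g, ((polynomialCombination (R := R) w s g : symmetricSubalgebra (Fin k) R) :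
      MvPolynomial (Fin k) R) = polynomialCombination w' (rectangleSchur R k n) g := fun g => by
    refine (map_polynomialCombination (symmetricSubalgebra (Fin k) R).val w s g).trans ?_
    congr 2
    · exact funext hw
    · exact funext fun μ => schurPolynomial_eq_schurSum R μ.1
  have hbij : Function.Bijective (polynomialCombination (R := R) w s) := by
    constructor
    · intro g g' h
      apply polynomialCombination_injective hkn hpow htop
      rw [← hval, ← hval, h]
    · intro f
      obtain ⟨g, hg⟩ := exists_polynomialCombination_eq (w := w') hkn hpow
        (fun c => by
          have := (y c - w c).2
          rwa [AddSubgroupClass.coe_sub, hy, hw] at this)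
        (fun c => by
          rw [← neg_sub]
          exact neg_mem (htop c).sub_mem) f.2
      exact ⟨g, Subtype.ext ((hval g).trans hg)⟩
  obtain ⟨b, hb⟩ := exists_basis_quotient_of_bijective hbij (I := grassmannianIdeal k n a)
    (span_range_triangularSolve _ _).symm
  exact ⟨Module.Free.of_basis b, b, fun μ => ⟨hs μ, hb μ⟩⟩
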